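/- **Notation.** Let $n\ge 1$. For $f\in\mathscr S(\mathbb R^n)$ let $\widehat f(\xi)=\int_{\mathbb R^n} f(x)e^{-2\pi i\langle x,\xi\rangle}\,dx$, with inverse denoted $f^\vee$; both are extended to tempered distributions. * For measurable $f$ let $f^*(t)=\inf\{a>0: |\{x:|f(x)|>a\}|\le t\}$ (with $\inf\emptyset=\infty$), and for $0<r<\infty$, $0<q\le\infty$ let $\|f\|_{L^{r,q}}=\big(\int_0^\infty (t^{1/r}f^*(t))^q\,\frac{dt}{t}\big)^{1/q}$ if $q<\infty$ and $\|f\|_{L^{r,\infty}}=\sup_{t>0}t^{1/r}f^*(t)$. For $s>0$ let $\|f\|_{L^{r,q}_s}=\|(I-\Delta)^{s/2}f\|_{L^{r,q}}$, where $(I-\Delta)^{s/2}f=\big((1+4\pi^2|\cdot|^2)^{s/2}\widehat f\,\big)^\vee$; this is $\infty$ if the distribution $(I-\Delta)^{s/2}f$ is not a function. * Fix $\Psi\in\mathscr S(\mathbb R^n)$ with $\widehat\Psi$ supported in $\{1/2<|\xi|<2\}$ and $\sum_{j\in\mathbb Z}\widehat\Psi(2^{-j}\xi)=1$ for $\xi\ne0$.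 * Fix $\Phi\in\mathscr S(\mathbb R^n)$ with $\int\Phi=1$ and $\widehat\Phi$ supported in $\{|\xi|\le2\}$, put $\Phi_k=2^{kn}\Phi(2^k\cdot)$, and for a tempered distribution $f$ and $0<p<\infty$ let $\|f\|_{H^p}=\big\|\sup_{k\in\mathbb Z}|\Phi_k*f|\big\|_{L^p}$. The space $H^p(\mathbb R^n)$ consists of the tempered distributions $f$ with $\|f\|_{H^p}<\infty$. * For an integrable function $\sigma:\mathbb R^n\to\mathbb C$ and $f\in\mathscr S(\mathbb R^n)$ let $T_\sigma f(x)=\int_{\mathbb R^n}\sigma(\xi)\widehat f(\xi)e^{2\pi i\langle x,\xi\rangle}\,d\xi$. We say that $T_\sigma$ is *bounded on $H^p(\mathbb R^n)$* if there is $C<\infty$ with $\|T_\sigma f\|_{H^p}\le C\|f\|_{H^p}$ for all $f\in\mathscr S(\mathbb R^n)\cap H^p(\mathbb R^n)$, and *unbounded on $H^p(\mathbb R^n)$* otherwise. * Let $\tau^{(s,p)}=\dfrac{n}{s-(n/\min(1,p)-n)}$. **Theorem.** Let $0<p<\infty$ and $|n/p-n/2|<s<n/\min(1,p)$. (i) For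 any $0<r<\tau^{(s,p)}$ and $0<q\le\infty$ there exists an integrable function $\sigma$ on $\mathbb R^n$, which is moreover bounded if $p<1$, such that $$\sup_{j\in\mathbb Z}\big\|\sigma(2^j\cdot)\widehat\Psi\big\|_{L^{r,q}_s(\mathbb R^n)}<\infty$$ and $T_\sigma$ is unbounded on $H^p(\mathbb R^n)$. (ii) For any $\min(1,p)<q\le\infty$ there exists an integrable function $\sigma$ on $\mathbb R^n$, which is moreover bounded if $p<1$, such that $$\sup_{j\in\mathbb Z}\big\|\sigma(2^j\cdot)\widehat\Psi\big\|_{L^{\tau^{(s,p)},q}_s(\mathbb R^n)}<\infty$$ and $T_\sigma$ is unbounded on $H^p(\mathbb R^n)$. -/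

import Mathlib

open MeasureTheory FourierTransform
open scoped SchwartzMap ENNReal NNReal

namespace HardyMultiplier

noncomputable section

/-- The Euclidean space `ℝⁿ`. -/
abbrev Rn (n : ℕ) : Type := EuclideanSpace ℝ (Fin n)

/-- The tempered distribution `u` is (given by) the function `g`: integration against `g` is
absolutely convergent on Schwartz functions and `u φ = ∫ φ g`. -/
def RepresentedBy {n : ℕ} (u : 𝓢'(Rn n, ℂ)) (g : Rn n → ℂ) : Prop :=
  AEStronglyMeasurable g volume ∧
    ∀ φ : 𝓢(Rn n, ℂ), Integrable (fun x => φ x * g x) volume ∧ u φ = ∫ x, φ x * g x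

/-! ### Lorentz and Lorentz-Sobolev norms -/

/-- The decreasing rearrangement `f^*(t) = inf {a > 0 : |{|f| > a}| ≤ t}`, where `inf ∅ = ∞`. -/
def rearrangement {n : ℕ} (f : Rn n → ℂ) (t : ℝ) : ℝ≥0∞ :=
  sInf {a : ℝ≥0∞ | 0 < a ∧ volume {x | a < ‖f x‖ₑ} ≤ ENNReal.ofReal t}

/-- The Lorentz (quasi-)norm `‖f‖_{L^{r,q}}` for `0 < r < ∞` and `0 < q ≤ ∞`:
`(∫_0^∞ (t^{1/r} f^*(t))^q dt/t)^{1/q}` if `q < ∞`, and `sup_{t>0} t^{1/r} f^*(t)` if `q = ∞`. -/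
def lorentzNorm {n : ℕ} (r : ℝ) (q : ℝ≥0∞) (f : Rn n → ℂ) : ℝ≥0∞ :=
  if q = ∞ then
    ⨆ t ∈ Set.Ioi (0 : ℝ), ENNReal.ofReal t ^ (1 / r) * rearrangement f t
  else
    (∫⁻ t in Set.Ioi (0 : ℝ),
      (ENNReal.ofReal t ^ (1 / r) * rearrangement f t) ^ q.toReal / ENNReal.ofReal t)
        ^ (1 / q.toReal)

/-- The Fourier symbol `(1 + 4π²|ξ|²)^{s/2}`. -/
def besselSymbol {n : ℕ} (s : ℝ) (ξ : Rn n) : ℂ :=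
  (((1 + 4 * Real.pi ^ 2 * ‖ξ‖ ^ 2) ^ (s / 2) : ℝ) : ℂ)

/-- The symbol `(1 + 4π²|ξ|²)^{s/2}` has temperate growth, so that multiplication by it acts on
tempered distributions. -/
theorem hasTemperateGrowth_besselSymbol {n : ℕ} (s : ℝ) :
    (besselSymbol s : Rn n → ℂ).HasTemperateGrowth := by
  have h := Function.HasTemperateGrowth.comp
    (Function.hasTemperateGrowth_one_add_norm_sq_rpow (Rn n) (s / 2))
    (((2 * Real.pi) • ContinuousLinearMap.id ℝ (Rn n)).hasTemperateGrowth)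
  have h2 := Function.HasTemperateGrowth.comp (Complex.ofRealCLM.hasTemperateGrowth) h
  convert h2 using 1
  funext ξ
  simp [besselSymbol, Function.comp_def, norm_smul, mul_pow, abs_of_pos Real.pi_pos]
  norm_num

/-- The operator `(I - Δ)^{s/2} u = ((1 + 4π²|·|²)^{s/2} û)^∨` on tempered distributions. -/
def fracLaplacian {n : ℕ} (s : ℝ) (u : 𝓢'(Rn n, ℂ)) : 𝓢'(Rn n, ℂ) :=
  TemperedDistribution.fourierMultiplierCLM ℂ (besselSymbol s) u

/-- The Lorentz-Sobolev norm `‖u‖_{L^{r,q}_s} = ‖(I - Δ)^{s/2} u‖_{L^{r,q}}`; it is `∞` if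
`(I - Δ)^{s/2} u` is not a function. -/
def lorentzSobolevNorm {n : ℕ} (s r : ℝ) (q : ℝ≥0∞) (u : 𝓢'(Rn n, ℂ)) : ℝ≥0∞ :=
  ⨅ (g : Rn n → ℂ) (_ : RepresentedBy (fracLaplacian s u) g), lorentzNorm r q g

/-- The Lorentz-Sobolev norm of a function `h`, regarded as a tempered distribution (`∞` if `h` is
not a tempered distribution). -/
def lorentzSobolevNormFun {n : ℕ} (s r : ℝ) (q : ℝ≥0∞) (h : Rn n → ℂ) : ℝ≥0∞ :=
  ⨅ (u : 𝓢'(Rn n, ℂ)) (_ : RepresentedBy u h), lorentzSobolevNorm s r q u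

/-! ### Hardy spaces -/

/-- `Φ` is a Schwartz function with `∫ Φ = 1` whose Fourier transform is supported in
`{|ξ| ≤ 2}`. -/
def IsHardyKernel {n : ℕ} (Φ : 𝓢(Rn n, ℂ)) : Prop :=
  ∫ x, Φ x = 1 ∧ ∀ ξ, 𝓕 Φ ξ ≠ 0 → ‖ξ‖ ≤ 2

/-- The invertible scalar `-2^k`. -/
def negTwoPow (k : ℤ) : ℝˣ := Units.mk0 (-(2 : ℝ) ^ k) (neg_ne_zero.mpr (by positivity))

/-- The Schwartz function `y ↦ Φ_k (x - y)`, where `Φ_k = 2^{kn} Φ(2^k ·)`. -/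
def dilatedKernel {n : ℕ} (Φ : 𝓢(Rn n, ℂ)) (k : ℤ) (x : Rn n) : 𝓢(Rn n, ℂ) :=
  ((2 : ℝ) ^ (k * (n : ℤ))) • SchwartzMap.compSubConstCLM ℝ x
    (SchwartzMap.compCLMOfContinuousLinearEquiv ℝ
      (ContinuousLinearEquiv.smulLeft (negTwoPow k) : Rn n ≃L[ℝ] Rn n) Φ)

theorem dilatedKernel_apply {n : ℕ} (Φ : 𝓢(Rn n, ℂ)) (k : ℤ) (x y : Rn n) :
    dilatedKernel Φ k x y = ((2 : ℝ) ^ (k * (n : ℤ))) • Φ ((2 : ℝ) ^ k • (x - y)) := by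
  have h : negTwoPow k • (y - x) = (2 : ℝ) ^ k • (x - y) := by
    rw [Units.smul_def, negTwoPow, Units.val_mk0, neg_smul, ← smul_neg, neg_sub]
  simp [dilatedKernel, h]

/-- The Hardy space (quasi-)norm `‖u‖_{H^p} = ‖ sup_k |Φ_k * u| ‖_{L^p}` of a tempered
distribution, where `(Φ_k * u)(x) = u(Φ_k(x - ·))`. -/
def hardyNorm {n : ℕ} (Φ : 𝓢(Rn n, ℂ)) (p : ℝ) (u : 𝓢'(Rn n, ℂ)) : ℝ≥0∞ :=
  (∫⁻ x, (⨆ k : ℤ, ‖u (dilatedKernel Φ k x)‖ₑ) ^ p) ^ (1 / p)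

/-! ### Multipliers -/

/-- `Ψ` is a Schwartz function whose Fourier transform is supported in `{1/2 < |ξ| < 2}` and
satisfies `∑_j Ψ̂(2^{-j} ξ) = 1` for `ξ ≠ 0`. -/
def IsDyadicPartition {n : ℕ} (Ψ : 𝓢(Rn n, ℂ)) : Prop :=
  (∀ ξ, 𝓕 Ψ ξ ≠ 0 → 1 / 2 < ‖ξ‖ ∧ ‖ξ‖ < 2) ∧
    ∀ ξ : Rn n, ξ ≠ 0 → HasSum (fun j : ℤ => 𝓕 Ψ ((2 : ℝ) ^ (-j) • ξ)) 1

/-- The multiplier operator `T_σ f(x) = ∫ σ(ξ) f̂(ξ) e^{2πi⟨x,ξ⟩} dξ`. -/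
def multiplierOp {n : ℕ} (σ : Rn n → ℂ) (f : 𝓢(Rn n, ℂ)) (x : Rn n) : ℂ :=
  ∫ ξ, σ ξ * 𝓕 f ξ * Complex.exp (2 * Real.pi * Complex.I * (inner ℝ x ξ : ℝ))

/-- `T_σ` is bounded on `H^p`: there is a finite `C` with `‖T_σ f‖_{H^p} ≤ C ‖f‖_{H^p}` for all
Schwartz functions `f` in `H^p`, where `T_σ f` is regarded as a tempered distribution. -/
def IsBoundedOnHardy {n : ℕ} (Φ : 𝓢(Rn n, ℂ)) (p : ℝ) (σ : Rn n → ℂ) : Prop :=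
  ∃ C : ℝ≥0, ∀ (f : 𝓢(Rn n, ℂ)) (u : 𝓢'(Rn n, ℂ)),
    hardyNorm Φ p (SchwartzMap.toTemperedDistributionCLM (Rn n) ℂ volume f) < ∞ →
    RepresentedBy u (multiplierOp σ f) →
    hardyNorm Φ p u ≤
      C * hardyNorm Φ p (SchwartzMap.toTemperedDistributionCLM (Rn n) ℂ volume f)

/-- The Hörmander quantity `sup_j ‖σ(2^j ·) Ψ̂‖_{L^{r,q}_s}`. -/
def hormanderSup {n : ℕ} (Ψ : 𝓢(Rn n, ℂ)) (s r : ℝ) (q : ℝ≥0∞) (σ : Rn n → ℂ) : ℝ≥0∞ :=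
  ⨆ j : ℤ, lorentzSobolevNormFun s r q (fun ξ => σ ((2 : ℝ) ^ j • ξ) * 𝓕 Ψ ξ)

/-- The critical exponent `τ^{(s,p)} = n / (s - (n / min(1,p) - n))`. -/
def tau (n : ℕ) (s p : ℝ) : ℝ := n / (s - (n / min 1 p - n))

end

end HardyMultiplier

/-!
Write `m = min 1 p` and `β = s - (n / m - n)`, so that `τ = n / β` and `0 < β < n`. Both parts are
witnessed by one multiplier, the lacunary series
`σ(ξ) = ∑ k, (k + 1) ^ (-1 / m) * 2 ^ (-k (n / m - n)) * θ (2 ^ k (ξ - a))`, where `‖a‖ = 2` and `θ`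
is a compactly supported nonnegative bump with nonnegative inverse Fourier transform.

*The Hörmander norm.* Only the pieces `σ(2 ^ j ·) Ψ̂` with `j = 0, 1, 2` are nonzero, and each is a
lacunary series of rescaled bumps. By scaling, `(I - Δ) ^ (s / 2)` of the `k`-th bump is `2 ^ (k s)`
times `(4 ^ (-k) - Δ) ^ (s / 2)` of a function from a bounded family in the Schwartz space, evaluated
at `2 ^ k (ξ - a)`. Applying `(δ² - Δ) ^ (s / 2)` with `0 < δ ≤ 1` to such a family gives functions
that decay, uniformly up to powers of `δ`, because derivatives of the symbol produce singularities
that are integrable up to a power of `δ` (`exists_decay_scaledBracket`). Summing over `k`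
(`exists_tsum_lacunary_le`) bounds `(I - Δ) ^ (s / 2)` of the series by
`(log (1 / ρ)) ^ (-1 / m) * ρ ^ (-β)` at small distance `ρ` from the centre, and by any negative
power of `ρ` at large distance. This belongs to `L^{r,q}` when `r < n / β`, and to `L^{n/β,q}` when
`q > m` (`lorentzSobolevNormFun_lacunary_lt_top`).

*Unboundedness.* The Hardy norm of `T_σ f` dominates its `L^p` norm, because
`Φ_k * T_σ f → T_σ f` pointwise (`lintegral_rpow_le_hardyNorm`). The test functions have Fourier
transform `φ (2 ^ l (ξ - a))` with a cutoff `φ`; as this is concentrated near `a ≠ 0`, their Hardy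
norm is at most comparable to their `L^p` norm (`exists_hardyNorm_testFunction_le`).

For `p ≤ 1` take `l = 0`. The cutoff equals one on the support of `σ`, so `T_σ f` is the inverse
Fourier transform of `σ`, a modulated series of nonnegative terms. On the annulus of radius `2 ^ l`
the `l`-th term alone contributes a multiple of `1 / (l + 1)` to the integral of `|T_σ f| ^ p`, which
is therefore infinite (`lintegral_multiplierOp_lacunary_eq_top`).

For `p ≥ 1` the multiplier is `∑ k, θ (2 ^ k (ξ - a)) / (k + 1)`, which has a doubly
logarithmic singularity at `a`. On the `l`-th test function it acts at least like multiplication by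
the harmonic sum `∑ k ≤ l, 1 / (k + 1)`, up to a constant (`le_norm_multiplierOp_testFunction`).
-/

namespace HardyMultiplier

/-! ### Dyadic bounds for integrals and Lorentz norms -/

theorem volume_ball_eq {n : ℕ} (a : Rn n) {ρ : ℝ} (hρ : 0 < ρ) :
    volume (Metric.ball a ρ) =
      ENNReal.ofReal (ρ ^ n * (volume (Metric.ball (0 : Rn n) 1)).toReal) := by
  rw [Measure.addHaar_ball_of_pos _ _ hρ, ENNReal.ofReal_mul (by positivity),
    ENNReal.ofReal_toReal measure_ball_lt_top.ne]
  simp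

theorem volume_unitBall_pos (n : ℕ) : 0 < (volume (Metric.ball (0 : Rn n) 1)).toReal :=
  ENNReal.toReal_pos (Metric.measure_ball_pos _ _ one_pos).ne' measure_ball_lt_top.ne

/-- The integral of a function that is at most `A i` outside the ball of radius `2 ^ i`, for all
`i`, is estimated by decomposing into dyadic annuli. -/
theorem lintegral_le_of_dyadic {n : ℕ} (hn : 0 < n) {f : Rn n → ℝ≥0∞} {a : Rn n} {A : ℤ → ℝ}
    (hf : ∀ (i : ℤ) (x : Rn n), (2 : ℝ) ^ i ≤ ‖x - a‖ → f x ≤ ENNReal.ofReal (A i)) :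
    ∫⁻ x, f x ≤ ∑' i : ℤ, ENNReal.ofReal (A i) * volume (Metric.ball a ((2 : ℝ) ^ (i + 1))) := by
  have : Nonempty (Fin n) := ⟨⟨0, hn⟩⟩
  -- The annuli cover everything except the centre, which is a null set as `n > 0`.
  set S : ℤ → Set (Rn n) := fun i => Metric.ball a ((2 : ℝ) ^ (i + 1)) ∩ {x | (2 : ℝ) ^ i ≤ ‖x - a‖}
  have hSm : ∀ i, MeasurableSet (S i) := fun i =>
    measurableSet_ball.inter (measurableSet_le measurable_const (by fun_prop))
  have hcov : ({a}ᶜ : Set (Rn n)) ⊆ ⋃ i, S i := by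
    intro x hx
    obtain ⟨i, hi⟩ := exists_mem_Ico_zpow (norm_pos_iff.2 (sub_ne_zero.2 hx)) (one_lt_two (α := ℝ))
    exact Set.mem_iUnion.2 ⟨i, by simpa [dist_eq_norm] using hi.2, hi.1⟩
  calc ∫⁻ x, f x = ∫⁻ x in ({a}ᶜ : Set (Rn n)), f x := by
        rw [setLIntegral_congr (t := Set.univ), setLIntegral_univ]
        exact (ae_eq_univ.2 (by simp))
    _ ≤ ∫⁻ x in ⋃ i, S i, f x := lintegral_mono_set hcov
    _ ≤ ∑' i, ∫⁻ x in S i, f x := lintegral_iUnion_le _ _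
    _ ≤ _ := by
        gcongr with i
        calc ∫⁻ x in S i, f x ≤ ∫⁻ x in S i, ENNReal.ofReal (A i) :=
              setLIntegral_mono' (hSm i) fun x hx => hf i x hx.2
          _ ≤ _ := by
            rw [setLIntegral_const]
            gcongr
            exact Set.inter_subset_left

theorem lintegral_lt_top_of_dyadic {n : ℕ} (hn : 0 < n) {f : Rn n → ℝ≥0∞} {a : Rn n} {A : ℤ → ℝ}
    (hA : ∀ i, 0 ≤ A i)
    (hf : ∀ (i : ℤ) (x : Rn n), (2 : ℝ) ^ i ≤ ‖x - a‖ → f x ≤ ENNReal.ofReal (A i))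
    (hs : Summable fun i : ℤ => ((2 : ℝ) ^ i) ^ n * A i) :
    ∫⁻ x, f x < ∞ := by
  refine (lintegral_le_of_dyadic hn hf).trans_lt ?_
  set v := (volume (Metric.ball (0 : Rn n) 1)).toReal
  have : ∀ i : ℤ, ENNReal.ofReal (A i) * volume (Metric.ball a ((2 : ℝ) ^ (i + 1))) =
      ENNReal.ofReal ((2 ^ n * v) * (((2 : ℝ) ^ i) ^ n * A i)) := by
    intro i
    rw [volume_ball_eq _ (by positivity), ← ENNReal.ofReal_mul (hA i), zpow_add₀ two_ne_zero,
      mul_pow]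
    congr 1
    simp only [zpow_one]
    ring
  simp_rw [this]
  exact (hs.mul_left _).tsum_ofReal_lt_top

theorem rearrangement_le {n : ℕ} {g : Rn n → ℂ} {a : Rn n} {A ρ t : ℝ} (hA : 0 < A) (hρ : 0 < ρ)
    (hg : ∀ x, ρ ≤ ‖x - a‖ → ‖g x‖ ≤ A)
    (ht : ρ ^ n * (volume (Metric.ball (0 : Rn n) 1)).toReal ≤ t) :
    rearrangement g t ≤ ENNReal.ofReal A := by
  refine sInf_le ⟨by simpa using hA, ?_⟩
  calc volume {x | ENNReal.ofReal A < ‖g x‖ₑ} ≤ volume (Metric.ball a ρ) := by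
        refine measure_mono fun x hx => ?_
        by_contra h
        rw [Metric.mem_ball, dist_eq_norm, not_lt] at h
        have h2 := hg x h
        rw [Set.mem_ofPred_eq, ← ofReal_norm, ENNReal.ofReal_lt_ofReal_iff'] at hx
        linarith [hx.1]
    _ ≤ _ := by
        rw [volume_ball_eq _ hρ]
        exact ENNReal.ofReal_le_ofReal ht

/-- A function bounded by `A i` outside the ball of radius `2 ^ i` satisfies
`t ^ (1 / r) * g^*(t) ≲ (2 ^ i) ^ (n / r) * A i` for `t` comparable to the measure of that ball. -/
theorem rpow_mul_rearrangement_le {n : ℕ} {g : Rn n → ℂ} {a : Rn n} {A : ℤ → ℝ}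
    (hA : ∀ i, 0 < A i) (hg : ∀ (i : ℤ) (x : Rn n), (2 : ℝ) ^ i ≤ ‖x - a‖ → ‖g x‖ ≤ A i)
    {r : ℝ} (hr : 0 < r) {v : ℝ} (hv : v = (volume (Metric.ball (0 : Rn n) 1)).toReal)
    {i : ℤ} {t : ℝ} (ht : t ∈ Set.Ico (v * (2 ^ n) ^ i) (v * (2 ^ n) ^ (i + 1))) :
    ENNReal.ofReal t ^ (1 / r) * rearrangement g t ≤
      ENNReal.ofReal ((v * 2 ^ n) ^ (1 / r) * (((2 : ℝ) ^ i) ^ (n / r) * A i)) := by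
  have hv0 : 0 < v := hv ▸ volume_unitBall_pos n
  have h2 : (((2 : ℝ) ^ n) ^ i) = ((2 : ℝ) ^ i) ^ n := by
    rw [← zpow_natCast, ← zpow_natCast, ← zpow_mul, ← zpow_mul, mul_comm]
  have ht0 : 0 ≤ t := le_trans (by positivity) ht.1
  have h3 : rearrangement g t ≤ ENNReal.ofReal (A i) := by
    refine rearrangement_le (hA i) (by positivity) (hg i) ?_
    rw [← hv, ← h2, mul_comm]
    exact ht.1
  rw [ENNReal.ofReal_rpow_of_nonneg ht0 (by positivity)]
  calc _ ≤ ENNReal.ofReal ((v * (2 ^ n) ^ (i + 1)) ^ (1 / r)) * ENNReal.ofReal (A i) := by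
        gcongr
        exact ht.2.le
    _ = _ := by
        rw [← ENNReal.ofReal_mul (by positivity), zpow_add₀ (by positivity), h2, zpow_one]
        congr 1
        have : (((2 : ℝ) ^ i) ^ n) ^ (1 / r) = ((2 : ℝ) ^ i) ^ (n / r) := by
          rw [← Real.rpow_natCast, ← Real.rpow_mul (by positivity)]
          congr 1
          ring
        rw [← this, show v * (((2 : ℝ) ^ i) ^ n * 2 ^ n) = (v * 2 ^ n) * ((2 : ℝ) ^ i) ^ n by ring,
          Real.mul_rpow (by positivity) (by positivity), mul_assoc]

theorem exists_mem_Ico_mul_zpow {n : ℕ} (hn : 0 < n) {v : ℝ} (hv : 0 < v) {t : ℝ} (ht : 0 < t) :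
    ∃ i : ℤ, t ∈ Set.Ico (v * (2 ^ n) ^ i) (v * (2 ^ n) ^ (i + 1)) := by
  obtain ⟨i, hi⟩ := exists_mem_Ico_zpow (div_pos ht hv)
    (one_lt_pow₀ (one_lt_two (α := ℝ)) hn.ne')
  rw [Set.mem_Ico, le_div_iff₀ hv, div_lt_iff₀ hv] at hi
  exact ⟨i, by rw [mul_comm]; exact hi.1, by rw [mul_comm]; exact hi.2⟩

theorem lorentzNorm_top_lt_top {n : ℕ} (hn : 0 < n) {g : Rn n → ℂ} {a : Rn n} {A : ℤ → ℝ}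
    (hA : ∀ i, 0 < A i) (hg : ∀ (i : ℤ) (x : Rn n), (2 : ℝ) ^ i ≤ ‖x - a‖ → ‖g x‖ ≤ A i)
    {r : ℝ} (hr : 0 < r) {M : ℝ} (hM : ∀ i : ℤ, ((2 : ℝ) ^ i) ^ (n / r) * A i ≤ M) :
    lorentzNorm r ∞ g < ∞ := by
  rw [lorentzNorm, if_pos rfl]
  set v := (volume (Metric.ball (0 : Rn n) 1)).toReal with hv
  have hv0 : 0 < v := volume_unitBall_pos n
  refine (iSup₂_le fun t ht => ?_).trans_lt
    (ENNReal.ofReal_lt_top (r := (v * 2 ^ n) ^ (1 / r) * M))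
  obtain ⟨i, hi⟩ := exists_mem_Ico_mul_zpow hn hv0 ht
  refine (rpow_mul_rearrangement_le hA hg hr hv hi).trans (ENNReal.ofReal_le_ofReal ?_)
  gcongr
  exact hM i

theorem lorentzNorm_lt_top {n : ℕ} (hn : 0 < n) {g : Rn n → ℂ} {a : Rn n} {A : ℤ → ℝ}
    (hA : ∀ i, 0 < A i) (hg : ∀ (i : ℤ) (x : Rn n), (2 : ℝ) ^ i ≤ ‖x - a‖ → ‖g x‖ ≤ A i)
    {r : ℝ} (hr : 0 < r) {q : ℝ≥0∞} (hq0 : 0 < q) (hq : q ≠ ∞)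
    (hs : Summable fun i : ℤ => (((2 : ℝ) ^ i) ^ (n / r) * A i) ^ q.toReal) :
    lorentzNorm r q g < ∞ := by
  rw [lorentzNorm, if_neg hq]
  set v := (volume (Metric.ball (0 : Rn n) 1)).toReal with hv
  have hv0 : 0 < v := volume_unitBall_pos n
  have hq' : 0 < q.toReal := ENNReal.toReal_pos hq0.ne' hq
  set K := (v * 2 ^ n) ^ (1 / r) with hK
  set T : ℤ → ℝ := fun i => ((2 : ℝ) ^ i) ^ (n / r) * A i with hT
  have hT0 : ∀ i, 0 < T i := fun i => mul_pos (by positivity) (hA i)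
  set S : ℤ → Set ℝ := fun i => Set.Ico (v * (2 ^ n) ^ i) (v * (2 ^ n) ^ (i + 1)) with hS
  refine ENNReal.rpow_lt_top_of_nonneg (by positivity) (ne_of_lt ?_)
  calc _ ≤ ∫⁻ t in ⋃ i, S i, (ENNReal.ofReal t ^ (1 / r) * rearrangement g t) ^ q.toReal /
          ENNReal.ofReal t := by
        refine lintegral_mono_set fun t ht => ?_
        exact Set.mem_iUnion.2 (exists_mem_Ico_mul_zpow hn hv0 ht)
    _ ≤ ∑' i, ∫⁻ t in S i, (ENNReal.ofReal t ^ (1 / r) * rearrangement g t) ^ q.toReal /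
          ENNReal.ofReal t := lintegral_iUnion_le _ _
    _ ≤ ∑' i, ENNReal.ofReal ((2 ^ n * K ^ q.toReal) * T i ^ q.toReal) := by
        gcongr with i
        have hpos : 0 < v * (2 ^ n) ^ i := by positivity
        calc _ ≤ ∫⁻ t in S i, ENNReal.ofReal ((K * T i) ^ q.toReal / (v * (2 ^ n) ^ i)) := by
              refine setLIntegral_mono' measurableSet_Ico fun t ht => ?_
              rw [ENNReal.ofReal_div_of_pos hpos,
                ← ENNReal.ofReal_rpow_of_nonneg (by have := hT0 i; positivity) hq'.le]
              gcongr
              · exact rpow_mul_rearrangement_le hA hg hr hv ht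
              · exact ht.1
          _ ≤ _ := by
              have := hT0 i
              rw [setLIntegral_const, Real.volume_Ico, ← ENNReal.ofReal_mul (by positivity)]
              refine ENNReal.ofReal_le_ofReal ?_
              rw [Real.mul_rpow (by positivity) (hT0 i).le, zpow_add₀ (by positivity), zpow_one,
                div_mul_eq_mul_div, div_le_iff₀ hpos]
              have h5 : v * ((2 ^ n) ^ i * 2 ^ n) - v * (2 ^ n) ^ i ≤ v * ((2 ^ n) ^ i * 2 ^ n) :=
                sub_le_self _ hpos.le
              calc _ ≤ K ^ q.toReal * T i ^ q.toReal * (v * ((2 ^ n) ^ i * 2 ^ n)) := by gcongr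
                _ = _ := by ring
    _ < ∞ := (hs.mul_left _).tsum_ofReal_lt_top

/-! ### Derivatives of powers of the Japanese bracket -/

section Bracket

variable {V : Type*} [NormedAddCommGroup V] [InnerProductSpace ℝ V]

theorem contDiff_one_add_norm_sq_rpow (r : ℝ) :
    ContDiff ℝ ⊤ fun x : V => (1 + ‖x‖ ^ 2) ^ r :=
  (contDiff_const.add (contDiff_norm_sq ℝ)).rpow_const_of_ne fun x => by positivity

/-- The real inner product as a bilinear map; `innerSL` has the type of a conjugate-linear map. -/
noncomputable def innerBilin : V →L[ℝ] V →L[ℝ] ℝ := innerSL ℝ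

theorem fderiv_one_add_norm_sq_rpow (r : ℝ) :
    fderiv ℝ (fun x : V => (1 + ‖x‖ ^ 2) ^ r) =
      fun x => (2 * r * (1 + ‖x‖ ^ 2) ^ (r - 1)) • innerBilin x := by
  funext x
  have h := ((hasStrictFDerivAt_norm_sq x).hasFDerivAt.const_add 1).rpow_const (p := r)
    (Or.inl (by positivity))
  rw [h.fderiv]
  ext y
  simp only [smul_apply, nsmul_eq_mul, smul_eq_mul, innerBilin]
  push_cast
  ring

/-- A linear map, bounded by the first power of the bracket, is a symbol of order one. -/
theorem norm_iteratedFDeriv_continuousLinearMap_le {W : Type*} [NormedAddCommGroup W]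
    [NormedSpace ℝ W] (L : V →L[ℝ] W) (hL : ‖L‖ ≤ 1) (m : ℕ) (x : V) :
    ‖iteratedFDeriv ℝ m L x‖ ≤ (1 + ‖x‖ ^ 2) ^ ((1 - m : ℝ) / 2) := by
  match m with
  | 0 =>
    rw [norm_iteratedFDeriv_zero, Nat.cast_zero, sub_zero, ← Real.sqrt_eq_rpow]
    refine (L.le_of_opNorm_le hL x).trans (Real.le_sqrt_of_sq_le ?_)
    rw [one_mul]
    linarith
  | 1 =>
    rw [norm_iteratedFDeriv_one, L.fderiv]
    simpa using hL
  | m + 2 =>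
    have h : fderiv ℝ L = fun _ => L := funext fun y => L.fderiv
    rw [← norm_iteratedFDeriv_fderiv, h, iteratedFDeriv_const_of_ne (Nat.succ_ne_zero m)]
    simp only [Pi.zero_apply, norm_zero]
    positivity

/-- Each derivative of `(1 + ‖x‖ ^ 2) ^ r` gains one power of decay. -/
theorem exists_norm_iteratedFDeriv_one_add_norm_sq_rpow_le (i : ℕ) (r : ℝ) :
    ∃ C : ℝ, 0 ≤ C ∧ ∀ x : V, ‖iteratedFDeriv ℝ i (fun y : V => (1 + ‖y‖ ^ 2) ^ r) x‖ ≤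
      C * (1 + ‖x‖ ^ 2) ^ (r - i / 2 : ℝ) := by
  induction i using Nat.strong_induction_on generalizing r with
  | _ i ih =>
  match i with
  | 0 =>
    refine ⟨1, zero_le_one, fun x => ?_⟩
    rw [norm_iteratedFDeriv_zero, Real.norm_of_nonneg (by positivity)]
    simp
  | i + 1 =>
    -- The gradient is `2 r (1 + ‖x‖ ^ 2) ^ (r - 1) x`; the Leibniz rule applies with the induction
    -- hypothesis for the exponent `r - 1` and all orders up to `i`.
    have ih' : ∀ j : ℕ, ∃ C : ℝ, 0 ≤ C ∧ (j ≤ i → ∀ x : V,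
        ‖iteratedFDeriv ℝ j (fun y : V => (1 + ‖y‖ ^ 2) ^ (r - 1)) x‖ ≤
          C * (1 + ‖x‖ ^ 2) ^ (r - 1 - j / 2 : ℝ)) := by
      intro j
      by_cases hj : j ≤ i
      · obtain ⟨C, hC, h⟩ := ih j (by omega) (r - 1)
        exact ⟨C, hC, fun _ => h⟩
      · exact ⟨0, le_rfl, fun h => absurd h hj⟩
    choose C hC0 hC using ih'
    refine ⟨|2 * r| * ∑ j ∈ Finset.range (i + 1), (i.choose j : ℝ) * C j,
      mul_nonneg (abs_nonneg _)
        (Finset.sum_nonneg fun j _ => mul_nonneg (by positivity) (hC0 j)), fun x => ?_⟩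
    have hf : fderiv ℝ (fun y : V => (1 + ‖y‖ ^ 2) ^ r) =
        (2 * r) • fun y => ((1 + ‖y‖ ^ 2) ^ (r - 1)) • (innerBilin y : V →L[ℝ] ℝ) := by
      rw [fderiv_one_add_norm_sq_rpow]
      funext y
      rw [Pi.smul_apply, smul_smul]
    have hc1 : ContDiff ℝ ⊤ fun y : V => (1 + ‖y‖ ^ 2) ^ (r - 1) :=
      contDiff_one_add_norm_sq_rpow _
    have hc2 : ContDiff ℝ ⊤ fun y : V => (innerBilin y : V →L[ℝ] ℝ) :=
      innerBilin.contDiff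
    rw [← norm_iteratedFDeriv_fderiv, hf,
      iteratedFDeriv_const_smul_apply (f := fun y : V => ((1 + ‖y‖ ^ 2) ^ (r - 1)) • innerBilin y)
        ((hc1.smul hc2).of_le le_top).contDiffAt, norm_smul,
      Real.norm_eq_abs, mul_assoc]
    gcongr
    refine (norm_iteratedFDeriv_smul_le hc1 hc2 x (n := i) le_top).trans ?_
    rw [Finset.sum_mul]
    refine Finset.sum_le_sum fun j hj => ?_
    rw [mul_assoc, mul_assoc]
    refine mul_le_mul_of_nonneg_left ?_ (Nat.cast_nonneg _)
    have hji : j ≤ i := Nat.lt_succ_iff.1 (Finset.mem_range.1 hj)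
    calc _ ≤ (C j * (1 + ‖x‖ ^ 2) ^ (r - 1 - j / 2 : ℝ)) *
          (1 + ‖x‖ ^ 2) ^ ((1 - (i - j : ℕ) : ℝ) / 2) := by
          gcongr
          · exact mul_nonneg (hC0 j) (by positivity)
          · exact hC j hji x
          · exact norm_iteratedFDeriv_continuousLinearMap_le innerBilin (norm_innerSL_le ℝ) _ _
      _ = _ := by
          rw [mul_assoc, ← Real.rpow_add (by positivity), Nat.cast_sub hji]
          congr 2
          push_cast
          ring

/-- The rescaled symbol `(δ² + 4π²‖x‖²) ^ (s / 2)` of `(δ² - Δ) ^ (s / 2)`. -/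
noncomputable def scaledBracket (δ s : ℝ) (x : V) : ℝ :=
  (δ ^ 2 + 4 * Real.pi ^ 2 * ‖x‖ ^ 2) ^ (s / 2)

theorem scaledBracket_eq {δ : ℝ} (hδ : 0 < δ) (s : ℝ) (x : V) :
    scaledBracket δ s x = δ ^ s * (1 + ‖(2 * Real.pi / δ) • x‖ ^ 2) ^ (s / 2) := by
  rw [scaledBracket, norm_smul, Real.norm_of_nonneg (by positivity),
    show δ ^ 2 + 4 * Real.pi ^ 2 * ‖x‖ ^ 2 = δ ^ 2 * (1 + (2 * Real.pi / δ * ‖x‖) ^ 2) by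
      field_simp; ring, Real.mul_rpow (by positivity) (by positivity), ← Real.rpow_natCast,
    ← Real.rpow_mul hδ.le]
  congr 2
  push_cast
  ring

theorem contDiff_scaledBracket {δ : ℝ} (hδ : 0 < δ) (s : ℝ) :
    ContDiff ℝ ⊤ (scaledBracket δ s : V → ℝ) := by
  rw [funext (scaledBracket_eq (V := V) hδ s)]
  exact contDiff_const.mul ((contDiff_one_add_norm_sq_rpow _).comp (contDiff_const_smul _))

theorem hasTemperateGrowth_scaledBracket {δ : ℝ} (hδ : 0 < δ) (s : ℝ) :
    (scaledBracket δ s : V → ℝ).HasTemperateGrowth := by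
  rw [funext (scaledBracket_eq (V := V) hδ s)]
  exact (Function.HasTemperateGrowth.const _).mul
    ((Function.hasTemperateGrowth_one_add_norm_sq_rpow V (s / 2)).comp
      ((2 * Real.pi / δ) • ContinuousLinearMap.id ℝ V).hasTemperateGrowth)

/-- Uniformly in `δ`, each derivative of the symbol of `(δ² - Δ) ^ (s / 2)` lowers its order by
one. -/
theorem exists_norm_iteratedFDeriv_scaledBracket_le (i : ℕ) (s : ℝ) :
    ∃ C : ℝ, 0 ≤ C ∧ ∀ δ : ℝ, 0 < δ → ∀ x : V,
      ‖iteratedFDeriv ℝ i (scaledBracket δ s : V → ℝ) x‖ ≤ C * scaledBracket δ (s - i) x := by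
  obtain ⟨C, hC, h⟩ := exists_norm_iteratedFDeriv_one_add_norm_sq_rpow_le (V := V) i (s / 2)
  refine ⟨(2 * Real.pi) ^ i * C, by positivity, fun δ hδ x => ?_⟩
  have hc : ContDiff ℝ ⊤ fun y : V => (1 + ‖y‖ ^ 2) ^ (s / 2) := contDiff_one_add_norm_sq_rpow _
  have hc' : ContDiff ℝ ⊤ fun y : V => (1 + ‖(2 * Real.pi / δ) • y‖ ^ 2) ^ (s / 2) :=
    hc.comp (contDiff_const_smul _)
  have he : (scaledBracket δ s : V → ℝ) =
      (δ ^ s) • fun y : V => (1 + ‖(2 * Real.pi / δ) • y‖ ^ 2) ^ (s / 2) :=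
    funext fun y => scaledBracket_eq hδ s y
  rw [he, iteratedFDeriv_const_smul_apply (hc'.of_le le_top).contDiffAt,
    iteratedFDeriv_comp_const_smul (f := fun y : V => (1 + ‖y‖ ^ 2) ^ (s / 2)) _
      (hc.of_le le_top), norm_smul, norm_smul, scaledBracket_eq hδ,
    Real.norm_of_nonneg (by positivity), Real.norm_of_nonneg (by positivity)]
  calc _ ≤ δ ^ s * ((2 * Real.pi / δ) ^ i *
        (C * (1 + ‖(2 * Real.pi / δ) • x‖ ^ 2) ^ (s / 2 - i / 2 : ℝ))) := by
        gcongr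
        exact h _
    _ = _ := by
        rw [Real.rpow_sub hδ, Real.rpow_natCast, div_pow, sub_div]
        ring

end Bracket

/-- For `0 < δ ≤ 1` the symbol of order `s - i` is at most an integrable singularity times a power
of `δ`, up to polynomial growth. -/
theorem scaledBracket_le {V : Type*} [NormedAddCommGroup V] {δ s γ : ℝ} (hδ : 0 < δ)
    (hδ1 : δ ≤ 1) (hs : 0 ≤ s) (hγ : 0 ≤ γ) {i N : ℕ} (hi : i ≤ N) {x : V} (hx : x ≠ 0) :
    scaledBracket δ (s - i) x ≤
      δ ^ (-(max (N - s - γ) 0)) * ((1 + ‖x‖ ^ (-γ)) * (2 * Real.pi * (1 + ‖x‖)) ^ s) := by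
  have hx0 : 0 < ‖x‖ := norm_pos_iff.2 hx
  set R := Real.sqrt (δ ^ 2 + 4 * Real.pi ^ 2 * ‖x‖ ^ 2) with hR
  have hR0 : 0 < R := Real.sqrt_pos.2 (by positivity)
  have hpi := Real.pi_gt_three
  have hRδ : δ ≤ R := Real.le_sqrt_of_sq_le (le_add_of_nonneg_right (by positivity))
  have hRx : ‖x‖ ≤ R := by
    refine Real.le_sqrt_of_sq_le ?_
    have : 1 ≤ 4 * Real.pi ^ 2 := by nlinarith
    nlinarith [sq_nonneg δ, sq_nonneg ‖x‖]
  have hRu : R ≤ 2 * Real.pi * (1 + ‖x‖) := by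
    refine Real.sqrt_le_iff.2 ⟨by positivity, ?_⟩
    have : δ ^ 2 ≤ 1 := pow_le_one₀ hδ.le hδ1
    nlinarith [mul_pos Real.pi_pos hx0, mul_pos (mul_pos Real.pi_pos Real.pi_pos) hx0]
  have hb1 : 1 ≤ 2 * Real.pi * (1 + ‖x‖) := by nlinarith
  have he : scaledBracket δ (s - i) x = R ^ (s - i) := by
    rw [scaledBracket, hR, Real.sqrt_eq_rpow, ← Real.rpow_mul (by positivity)]
    congr 1
    ring
  have hd1 : 1 ≤ δ ^ (-(max (N - s - γ) 0)) :=
    Real.one_le_rpow_of_pos_of_le_one_of_nonpos hδ hδ1 (by simp)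
  have hx1 : 0 ≤ ‖x‖ ^ (-γ) := by positivity
  have hp1 : 1 ≤ (2 * Real.pi * (1 + ‖x‖)) ^ s := Real.one_le_rpow hb1 hs
  rw [he]
  -- The symbol is `R ^ (s - i)`, where `max δ ‖x‖ ≤ R ≤ 2π (1 + ‖x‖)`. It is singular only
  -- if `R < 1` and `i > s`; then up to `γ` negative powers of `R` are spent on `‖x‖`, the others on `δ`.
  rcases le_or_gt (i : ℝ) s with his | his
  · calc R ^ (s - i) ≤ (2 * Real.pi * (1 + ‖x‖)) ^ (s - i) := by gcongr
      _ ≤ (2 * Real.pi * (1 + ‖x‖)) ^ s :=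
        Real.rpow_le_rpow_of_exponent_le hb1 (by linarith [(Nat.cast_nonneg i : (0 : ℝ) ≤ i)])
      _ = 1 * (1 * (2 * Real.pi * (1 + ‖x‖)) ^ s) := by ring
      _ ≤ _ := by gcongr; linarith
  · suffices h : R ^ (s - i) ≤ δ ^ (-(max (N - s - γ) 0)) * (1 + ‖x‖ ^ (-γ)) by
      calc _ ≤ δ ^ (-(max (N - s - γ) 0)) * (1 + ‖x‖ ^ (-γ)) * 1 := by rw [mul_one]; exact h
        _ ≤ δ ^ (-(max (N - s - γ) 0)) * (1 + ‖x‖ ^ (-γ)) * (2 * Real.pi * (1 + ‖x‖)) ^ s := by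
          gcongr
        _ = _ := by ring
    rcases le_or_gt 1 R with hR1 | hR1
    · calc R ^ (s - i) ≤ 1 := Real.rpow_le_one_of_one_le_of_nonpos hR1 (by linarith)
        _ = 1 * 1 := by ring
        _ ≤ _ := by gcongr; linarith
    · rcases le_or_gt (i - s) γ with hiγ | hiγ
      · calc R ^ (s - i) ≤ R ^ (-γ) :=
              Real.rpow_le_rpow_of_exponent_ge hR0 hR1.le (by linarith)
          _ ≤ ‖x‖ ^ (-γ) := Real.rpow_le_rpow_of_nonpos hx0 hRx (by linarith)
          _ ≤ 1 * (1 + ‖x‖ ^ (-γ)) := by linarith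
          _ ≤ _ := by gcongr
      · have hiN : (i : ℝ) ≤ N := by exact_mod_cast hi
        calc R ^ (s - i) = R ^ (-(i - s - γ)) * R ^ (-γ) := by
              rw [← Real.rpow_add hR0]
              congr 1
              ring
          _ ≤ δ ^ (-(i - s - γ)) * ‖x‖ ^ (-γ) := by
              gcongr ?_ * ?_
              · exact Real.rpow_le_rpow_of_nonpos hδ hRδ (by linarith)
              · exact Real.rpow_le_rpow_of_nonpos hx0 hRx (by linarith)
          _ ≤ δ ^ (-(max (N - s - γ) 0)) * (1 + ‖x‖ ^ (-γ)) := by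
              gcongr ?_ * ?_
              · refine Real.rpow_le_rpow_of_exponent_ge hδ hδ1 ?_
                rw [neg_le_neg_iff]
                exact (by linarith : (i : ℝ) - s - γ ≤ N - s - γ).trans (le_max_left _ _)
              · linarith

/-! ### Bounded families of Schwartz functions -/

section Bounded

variable {V : Type*} [NormedAddCommGroup V] [InnerProductSpace ℝ V]

/-- The Schwartz function `η ↦ χ (b + δ η) θ η`: the part of `χ` in a window of size `δ` around `b`,
rescaled to unit size. -/
noncomputable def windowed (χ θ : 𝓢(V, ℂ)) (b : V) (δ : ℝ) : 𝓢(V, ℂ) :=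
  SchwartzMap.smulLeftCLM ℂ (fun η => χ (b + δ • η)) θ

theorem windowed_apply (χ θ : 𝓢(V, ℂ)) (b : V) (δ : ℝ) (η : V) :
    windowed χ θ b δ η = χ (b + δ • η) * θ η := by
  have h : (fun η => χ (b + δ • η)).HasTemperateGrowth :=
    χ.hasTemperateGrowth.comp ((Function.HasTemperateGrowth.const b).add
      (δ • ContinuousLinearMap.id ℝ V).hasTemperateGrowth)
  rw [windowed, SchwartzMap.smulLeftCLM_apply_apply h, smul_eq_mul]

/-- Uniform Schwartz bounds for the functions `η ↦ χ (b + δ η) θ η` with `|δ| ≤ 1`. -/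
theorem isVonNBounded_windowed (χ θ : 𝓢(V, ℂ)) :
    Bornology.IsVonNBounded ℂ {f | ∃ (b : V) (δ : ℝ), |δ| ≤ 1 ∧ f = windowed χ θ b δ} := by
  rw [(schwartz_withSeminorms ℂ V ℂ).isVonNBounded_iff_seminorm_bounded]
  rintro ⟨k, m⟩
  set M := ∑ j ∈ Finset.range (m + 1), (m.choose j : ℝ) * SchwartzMap.seminorm ℂ 0 j χ *
    SchwartzMap.seminorm ℂ k (m - j) θ with hM
  have hM0 : 0 ≤ M := Finset.sum_nonneg fun j _ => by positivity
  refine ⟨M + 1, by positivity, ?_⟩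
  rintro f ⟨b, δ, hδ, rfl⟩
  refine lt_of_le_of_lt (SchwartzMap.seminorm_le_bound ℂ k m _ hM0 fun x => ?_) (lt_add_one M)
  have hc : ContDiff ℝ (⊤ : ℕ∞) fun y => χ (b + y) :=
    (χ.smooth ⊤).comp (contDiff_const.add contDiff_id)
  have hc' : ContDiff ℝ (⊤ : ℕ∞) fun y => χ (b + δ • y) := hc.comp (contDiff_const_smul δ)
  have he : (windowed χ θ b δ : V → ℂ) = fun y => χ (b + δ • y) * θ y :=
    funext (windowed_apply χ θ b δ)
  rw [he]
  calc _ ≤ ‖x‖ ^ k * ∑ j ∈ Finset.range (m + 1),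
        (m.choose j : ℝ) * ‖iteratedFDeriv ℝ j (fun y => χ (b + δ • y)) x‖ *
          ‖iteratedFDeriv ℝ (m - j) θ x‖ := by
        gcongr
        exact norm_iteratedFDeriv_mul_le hc' (θ.smooth ⊤) x (mod_cast le_top)
    _ ≤ M := by
        rw [Finset.mul_sum]
        refine Finset.sum_le_sum fun j _ => ?_
        have h1 : ‖iteratedFDeriv ℝ j (fun y => χ (b + δ • y)) x‖ ≤
            SchwartzMap.seminorm ℂ 0 j χ := by
          rw [iteratedFDeriv_comp_const_smul (f := fun y => χ (b + y)) δ
            (hc.of_le (mod_cast le_top))]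
          simp only [iteratedFDeriv_comp_add_left, norm_smul, norm_pow, Real.norm_eq_abs]
          calc _ ≤ 1 * SchwartzMap.seminorm ℂ 0 j χ := by
                gcongr
                · exact pow_le_one₀ (abs_nonneg _) hδ
                · exact χ.norm_iteratedFDeriv_le_seminorm ℂ j _
            _ = _ := one_mul _
        calc _ = (m.choose j : ℝ) * ‖iteratedFDeriv ℝ j (fun y => χ (b + δ • y)) x‖ *
              (‖x‖ ^ k * ‖iteratedFDeriv ℝ (m - j) θ x‖) := by ring
          _ ≤ _ := by
            gcongr
            exact θ.le_seminorm ℂ k (m - j) x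

/-- Boundedness in the Schwartz space, expressed by the weights `(1 + ‖x‖) ^ k`. -/
theorem exists_pow_mul_norm_iteratedFDeriv_le {S : Set 𝓢(V, ℂ)} (hS : Bornology.IsVonNBounded ℂ S)
    (k m : ℕ) : ∃ C : ℝ, 0 ≤ C ∧ ∀ f ∈ S, ∀ x,
      (1 + ‖x‖) ^ k * ‖iteratedFDeriv ℝ m f x‖ ≤ C := by
  rw [(schwartz_withSeminorms ℂ V ℂ).isVonNBounded_iff_finset_seminorm_bounded] at hS
  obtain ⟨r, hr, h⟩ := hS (Finset.Iic (k, m))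
  refine ⟨2 ^ k * r, by positivity, fun f hf x => ?_⟩
  refine (SchwartzMap.one_add_le_sup_seminorm_apply (𝕜 := ℂ) (m := (k, m)) le_rfl le_rfl f
    x).trans ?_
  gcongr
  exact (h f hf).le

end Bounded

/-! ### Fractional powers of the Laplacian on rescaled bumps -/

/-- A locally integrable singularity times a sufficiently decaying factor is integrable. -/
theorem integrable_one_add_rpow_mul {n : ℕ} (hn : 0 < n) {γ : ℝ} (hγ0 : 0 ≤ γ) (hγ : γ < n) :
    Integrable fun x : Rn n => (1 + ‖x‖ ^ (-γ)) * ((1 + ‖x‖) ^ (n + 1))⁻¹ := by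
  refine ⟨by fun_prop, ?_⟩
  set A : ℤ → ℝ := fun i => (1 + ((2 : ℝ) ^ i) ^ (-γ)) * ((1 + (2 : ℝ) ^ i) ^ (n + 1))⁻¹ with hA
  have hA0 : ∀ i, 0 ≤ A i := fun i => by positivity
  refine lintegral_lt_top_of_dyadic hn (a := 0) hA0 (fun i x hx => ?_) ?_
  · rw [sub_zero] at hx
    rw [Real.enorm_of_nonneg (by positivity)]
    refine ENNReal.ofReal_le_ofReal ?_
    simp only [hA]
    have := Real.rpow_le_rpow_of_nonpos (by positivity) hx (neg_nonpos.2 hγ0)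
    gcongr
  · refine Summable.of_nat_of_neg ?_ ?_
    · refine Summable.of_nonneg_of_le (fun l => by have := hA0 l; positivity) (fun l => ?_)
        ((summable_geometric_two).mul_left 2)
      simp only [hA, zpow_natCast]
      have h1 : ((2 : ℝ) ^ l) ^ (-γ) ≤ 1 :=
        Real.rpow_le_one_of_one_le_of_nonpos (one_le_pow₀ one_le_two) (by linarith)
      calc _ ≤ ((2 : ℝ) ^ l) ^ n * ((1 + 1) * (((2 : ℝ) ^ l) ^ (n + 1))⁻¹) := by
            gcongr
            linarith
        _ = _ := by
            rw [one_div, inv_pow]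
            field_simp
            ring
    · have hlt : (2 : ℝ) ^ (γ - n) < 1 :=
        Real.rpow_lt_one_of_one_lt_of_neg one_lt_two (by linarith)
      refine Summable.of_nonneg_of_le (fun l => by have := hA0 (-l); positivity) (fun l => ?_)
        ((summable_geometric_of_lt_one (by positivity) hlt).mul_left 2)
      have h1 : (1 : ℝ) ≤ ((2 : ℝ) ^ (-(l : ℤ))) ^ (-γ) :=
        Real.one_le_rpow_of_pos_of_le_one_of_nonpos (by positivity)
          (zpow_le_one_of_nonpos₀ one_le_two (by simp)) (by linarith)
      calc _ ≤ ((2 : ℝ) ^ (-(l : ℤ))) ^ n * ((((2 : ℝ) ^ (-(l : ℤ))) ^ (-γ) +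
            ((2 : ℝ) ^ (-(l : ℤ))) ^ (-γ)) * 1) := by
            simp only [hA]
            gcongr
            exact inv_le_one_of_one_le₀ (one_le_pow₀ (by simp))
        _ = _ := by
            rw [← Real.rpow_natCast, ← Real.rpow_natCast, ← Real.rpow_intCast,
              ← Real.rpow_mul two_pos.le, ← Real.rpow_mul two_pos.le,
              ← Real.rpow_mul two_pos.le, mul_one, ← two_mul, mul_left_comm,
              ← Real.rpow_add two_pos]
            congr 2
            push_cast
            ring

/-- Pointwise decay of `(δ² - Δ) ^ (s / 2) B`, uniform over bounded families of Schwartz functions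
`B` (with Fourier transforms `H`) and `0 < δ ≤ 1`. -/
theorem exists_decay_scaledBracket {n : ℕ} (hn : 0 < n) {s γ : ℝ} (hs : 0 ≤ s) (hγ0 : 0 ≤ γ)
    (hγ : γ < n) {S : Set 𝓢(Rn n, ℂ)} (hS : Bornology.IsVonNBounded ℂ S) (N : ℕ) :
    ∃ C : ℝ, 0 ≤ C ∧ ∀ H ∈ S, ∀ δ : ℝ, 0 < δ → δ ≤ 1 → ∀ η : Rn n,
      ‖η‖ ^ N * ‖𝓕⁻ (SchwartzMap.smulLeftCLM ℂ (scaledBracket δ s : Rn n → ℝ) H) η‖ ≤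
        C * δ ^ (-(max (N - s - γ) 0)) := by
  have : Nonempty (Fin n) := ⟨⟨0, hn⟩⟩
  -- The decay of order `M` absorbs the growth of the symbol, and `n + 1` more powers make the
  -- derivatives integrable.
  obtain ⟨M, hM⟩ := exists_nat_ge s
  choose Cw hCw0 hCw using fun i => exists_norm_iteratedFDeriv_scaledBracket_le (V := Rn n) i s
  choose Ch hCh0 hCh using fun m => exists_pow_mul_norm_iteratedFDeriv_le hS (M + (n + 1)) m
  set J : Rn n → ℝ := fun x => (1 + ‖x‖ ^ (-γ)) * ((1 + ‖x‖) ^ (n + 1))⁻¹ with hJ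
  have hJi : Integrable J := integrable_one_add_rpow_mul hn hγ0 hγ
  set K : ℕ → ℝ := fun i => ∑ j ∈ Finset.range (i + 1),
    (i.choose j : ℝ) * (Cw j * Ch (i - j) * (2 * Real.pi) ^ s) with hK
  have hK0 : ∀ i, 0 ≤ K i := fun i => Finset.sum_nonneg fun j _ => by
    have := hCw0 j; have := hCh0 (i - j); positivity
  refine ⟨2 ^ N * ∑ i ∈ Finset.range (N + 1), K i * ∫ x, J x, ?_, ?_⟩
  · have : 0 ≤ ∫ x, J x := integral_nonneg fun x => by positivity
    exact mul_nonneg (by positivity)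
      (Finset.sum_nonneg fun i _ => mul_nonneg (hK0 i) this)
  intro H hH δ hδ hδ1 η
  set F := SchwartzMap.smulLeftCLM ℂ (scaledBracket δ s : Rn n → ℝ) H with hF
  set D := δ ^ (-(max (N - s - γ) 0)) with hD
  have hFe : (F : Rn n → ℂ) = fun x => scaledBracket δ s x • H x :=
    funext fun x => SchwartzMap.smulLeftCLM_apply_apply (hasTemperateGrowth_scaledBracket hδ s) H x
  have hpt : ∀ i ≤ N, ∀ x : Rn n, x ≠ 0 → ‖iteratedFDeriv ℝ i F x‖ ≤ D * K i * J x := by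
    intro i hi x hx
    rw [hFe]
    refine (norm_iteratedFDeriv_smul_le ((contDiff_scaledBracket hδ s).of_le le_top) (H.smooth ⊤) x
      (n := i) (N := (⊤ : ℕ∞)) (mod_cast le_top)).trans ?_
    rw [hK, mul_assoc, Finset.sum_mul, Finset.mul_sum]
    refine Finset.sum_le_sum fun j hj => ?_
    have hji : j ≤ i := Nat.lt_succ_iff.1 (Finset.mem_range.1 hj)
    have h1 : ‖iteratedFDeriv ℝ j (scaledBracket δ s : Rn n → ℝ) x‖ ≤
        Cw j * (D * ((1 + ‖x‖ ^ (-γ)) * (2 * Real.pi * (1 + ‖x‖)) ^ s)) :=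
      (hCw j δ hδ x).trans (mul_le_mul_of_nonneg_left
        (scaledBracket_le hδ hδ1 hs hγ0 (hji.trans hi) hx) (hCw0 j))
    have h2 : ‖iteratedFDeriv ℝ (i - j) H x‖ ≤ Ch (i - j) * ((1 + ‖x‖) ^ (M + (n + 1)))⁻¹ := by
      rw [← div_eq_mul_inv, le_div_iff₀ (by positivity), mul_comm]
      exact hCh (i - j) H hH x
    have h3 : (2 * Real.pi * (1 + ‖x‖)) ^ s * ((1 + ‖x‖) ^ (M + (n + 1)))⁻¹ ≤
        (2 * Real.pi) ^ s * ((1 + ‖x‖) ^ (n + 1))⁻¹ := by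
      have h4 : (1 + ‖x‖) ^ s ≤ (1 + ‖x‖) ^ M := by
        rw [← Real.rpow_natCast]
        exact Real.rpow_le_rpow_of_exponent_le (by linarith [norm_nonneg x]) hM
      rw [Real.mul_rpow (by positivity) (by positivity), pow_add, mul_inv, mul_assoc]
      refine mul_le_mul_of_nonneg_left ?_ (by positivity)
      rw [← mul_assoc]
      refine mul_le_of_le_one_left (by positivity) ?_
      rw [← div_eq_mul_inv]
      exact div_le_one_of_le₀ h4 (by positivity)
    have hD0 : 0 < D := by positivity
    have := hCw0 j
    have := hCh0 (i - j)
    calc _ = (i.choose j : ℝ) * (‖iteratedFDeriv ℝ j (scaledBracket δ s : Rn n → ℝ) x‖ *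
          ‖iteratedFDeriv ℝ (i - j) H x‖) := by ring
      _ ≤ (i.choose j : ℝ) * ((Cw j * (D * ((1 + ‖x‖ ^ (-γ)) * (2 * Real.pi * (1 + ‖x‖)) ^ s))) *
          (Ch (i - j) * ((1 + ‖x‖) ^ (M + (n + 1)))⁻¹)) := by gcongr
      _ = (i.choose j : ℝ) * (Cw j * Ch (i - j) * D * (1 + ‖x‖ ^ (-γ)) *
          ((2 * Real.pi * (1 + ‖x‖)) ^ s * ((1 + ‖x‖) ^ (M + (n + 1)))⁻¹)) := by ring
      _ ≤ (i.choose j : ℝ) * (Cw j * Ch (i - j) * D * (1 + ‖x‖ ^ (-γ)) *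
          ((2 * Real.pi) ^ s * ((1 + ‖x‖) ^ (n + 1))⁻¹)) := by gcongr
      _ = _ := by simp only [hJ]; ring
  have hint : ∀ i ≤ N, ∫ x, ‖iteratedFDeriv ℝ i F x‖ ≤ D * (K i * ∫ x, J x) := by
    intro i hi
    rw [← mul_assoc, ← integral_const_mul]
    refine integral_mono_ae ?_ (hJi.const_mul _) ?_
    · simpa using F.integrable_pow_mul_iteratedFDeriv volume 0 i
    · filter_upwards [compl_mem_ae_iff.2 (measure_singleton (0 : Rn n))] with x hx
      exact hpt i hi x hx
  -- Multiplication by `‖η‖ ^ N` is controlled by the `L¹` norms of the derivatives of order at most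
  -- `N` on the Fourier side.
  have h := Real.pow_mul_norm_iteratedFDeriv_fourier_le (F.smooth ⊤)
    (fun k m _ _ => F.integrable_pow_mul_iteratedFDeriv volume k m) (K := ⊤) (k := 0) (n := N)
    le_top le_top (-η)
  rw [norm_neg, norm_iteratedFDeriv_zero, ← Real.fourierInv_eq_fourier_neg] at h
  rw [SchwartzMap.fourierInv_coe]
  refine h.trans ?_
  simp only [pow_zero, CharP.cast_eq_zero, mul_zero, zero_add, one_mul, Finset.range_one,
    Finset.singleton_product, Finset.sum_map, Function.Embedding.coeFn_mk]
  rw [mul_assoc]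
  gcongr
  rw [Finset.sum_mul]
  refine Finset.sum_le_sum fun i hi => ?_
  rw [mul_comm]
  exact hint i (Nat.lt_succ_iff.1 (Finset.mem_range.1 hi))

/-! ### Functions as tempered distributions -/

theorem exists_representedBy {n : ℕ} {g : Rn n → ℂ} {p : ℝ≥0∞} (hp : 1 ≤ p)
    (hg : MemLp g p volume) : ∃ u : 𝓢'(Rn n, ℂ), RepresentedBy u g := by
  have : Fact (1 ≤ p) := ⟨hp⟩
  refine ⟨Lp.toTemperedDistribution (hg.toLp g), hg.1, fun φ => ⟨?_, ?_⟩⟩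
  · have := ENNReal.HolderConjugate.inv_one_sub_inv' hp
    exact ((φ.memLp (1 - p⁻¹)⁻¹ volume).integrable_mul hg :)
  · rw [Lp.toTemperedDistribution_apply]
    refine integral_congr_ae ?_
    filter_upwards [hg.coeFn_toLp] with x hx
    rw [hx, smul_eq_mul]

theorem aestronglyMeasurable_tsum {n : ℕ} {f : ℕ → Rn n → ℂ}
    (hf : ∀ k, AEStronglyMeasurable (f k) volume)
    (hs : ∫⁻ x, ∑' k, ‖f k x‖ₑ < ∞) :
    AEStronglyMeasurable (fun x => ∑' k, f k x) volume := by
  refine aestronglyMeasurable_of_tendsto_ae (u := Filter.atTop)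
    (f := fun N x => ∑ k ∈ Finset.range N, f k x)
    (fun N => by
      have := Finset.aestronglyMeasurable_sum (Finset.range N) (fun k _ => hf k)
      refine this.congr (Filter.Eventually.of_forall fun x => by simp)) ?_
  have hm : AEMeasurable (fun x => ∑' k, ‖f k x‖ₑ) volume :=
    AEMeasurable.tsum fun k => (hf k).enorm
  filter_upwards [ae_lt_top' hm hs.ne] with x hx
  have hsum : Summable fun k => f k x := by
    refine Summable.of_norm ?_
    have h2 : ∑' k, ENNReal.ofReal ‖f k x‖ ≠ ∞ := by simpa only [ofReal_norm] using hx.ne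
    exact (ENNReal.summable_toReal h2).congr fun k => by simp
  exact hsum.hasSum.tendsto_sum_nat

theorem integrable_tsum_of_lintegral {n : ℕ} {f : ℕ → Rn n → ℂ}
    (hf : ∀ k, AEStronglyMeasurable (f k) volume)
    (hs : ∫⁻ x, ∑' k, ‖f k x‖ₑ < ∞) :
    Integrable (fun x => ∑' k, f k x) volume :=
  ⟨aestronglyMeasurable_tsum hf hs,
    (lintegral_mono fun _ => enorm_tsum_le_tsum_enorm).trans_lt hs⟩

theorem integral_schwartz_mul_tsum {n : ℕ} (φ : 𝓢(Rn n, ℂ)) {f : ℕ → Rn n → ℂ}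
    (hf : ∀ k, AEStronglyMeasurable (f k) volume)
    (hs : ∫⁻ x, ∑' k, ‖f k x‖ₑ < ∞) :
    ∫ x, φ x * ∑' k, f k x = ∑' k, ∫ x, φ x * f k x := by
  simp_rw [← tsum_mul_left]
  refine integral_tsum (fun k => φ.continuous.aestronglyMeasurable.mul (hf k)) ?_
  rw [lintegral_tsum fun k => (hf k).enorm] at hs
  refine ne_top_of_le_ne_top (ENNReal.mul_ne_top ENNReal.ofReal_ne_top hs.ne)
    (b := ENNReal.ofReal (SchwartzMap.seminorm ℂ 0 0 φ) * _) ?_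
  rw [← ENNReal.tsum_mul_left]
  refine ENNReal.tsum_le_tsum fun k => ?_
  rw [← lintegral_const_mul' _ _ ENNReal.ofReal_ne_top]
  refine lintegral_mono fun x => ?_
  rw [enorm_mul]
  gcongr
  rw [← ofReal_norm]
  exact ENNReal.ofReal_le_ofReal (φ.norm_le_seminorm ℂ x)

theorem fracLaplacian_apply {n : ℕ} (s : ℝ) (u : 𝓢'(Rn n, ℂ)) (φ : 𝓢(Rn n, ℂ)) :
    fracLaplacian s u φ = u (𝓕 (SchwartzMap.smulLeftCLM ℂ (besselSymbol s) (𝓕⁻ φ))) := rfl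

/-- `(I - Δ) ^ (s / 2)` is its own transpose. -/
theorem integral_fourier_smulLeft_fourierInv_mul {n : ℕ} (s : ℝ) (φ h : 𝓢(Rn n, ℂ)) :
    ∫ x, 𝓕 (SchwartzMap.smulLeftCLM ℂ (besselSymbol s) (𝓕⁻ φ)) x * h x =
      ∫ x, φ x * SchwartzMap.fourierMultiplierCLM ℂ (besselSymbol s) h x := by
  rw [SchwartzMap.integral_fourier_mul_eq, SchwartzMap.fourierMultiplierCLM_apply,
    ← SchwartzMap.integral_fourierInv_mul_eq]
  refine integral_congr_ae (Filter.Eventually.of_forall fun x => ?_)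
  simp only [SchwartzMap.smulLeftCLM_apply_apply (hasTemperateGrowth_besselSymbol s), smul_eq_mul]
  ring

/-- `(I - Δ) ^ (s / 2)` may be applied termwise to a series of Schwartz functions that converges
absolutely in `L¹` together with the series of the images. -/
theorem lorentzSobolevNormFun_tsum_le {n : ℕ} (s r : ℝ) (q : ℝ≥0∞) (h : ℕ → 𝓢(Rn n, ℂ))
    (hh : ∫⁻ x, ∑' k, ‖h k x‖ₑ < ∞)
    (hF : ∫⁻ x, ∑' k, ‖SchwartzMap.fourierMultiplierCLM ℂ (besselSymbol s) (h k) x‖ₑ < ∞) :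
    lorentzSobolevNormFun s r q (fun x => ∑' k, h k x) ≤
      lorentzNorm r q fun x =>
        ∑' k, SchwartzMap.fourierMultiplierCLM ℂ (besselSymbol s) (h k) x := by
  have hhm : ∀ k, AEStronglyMeasurable (h k) volume :=
    fun k => (h k).continuous.aestronglyMeasurable
  have hFm : ∀ k, AEStronglyMeasurable
      (SchwartzMap.fourierMultiplierCLM ℂ (besselSymbol s) (h k)) volume :=
    fun k => (SchwartzMap.fourierMultiplierCLM ℂ (besselSymbol s)
      (h k)).continuous.aestronglyMeasurable
  obtain ⟨u, hu⟩ := exists_representedBy le_rfl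
    (memLp_one_iff_integrable.2 (integrable_tsum_of_lintegral hhm hh))
  refine iInf₂_le_of_le u hu
    (iInf₂_le_of_le _ ⟨aestronglyMeasurable_tsum hFm hF, fun φ => ?_⟩ le_rfl)
  refine ⟨((φ.memLp ∞ volume).integrable_mul
    (memLp_one_iff_integrable.2 (integrable_tsum_of_lintegral hFm hF)) :), ?_⟩
  rw [fracLaplacian_apply, (hu.2 _).2, integral_schwartz_mul_tsum _ hhm hh,
    integral_schwartz_mul_tsum _ hFm hF]
  simp_rw [integral_fourier_smulLeft_fourierInv_mul]

/-! ### Dilations and translations -/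

/-- The Schwartz function `ξ ↦ B (c (ξ - a))`. -/
noncomputable def affineComp {n : ℕ} (B : 𝓢(Rn n, ℂ)) (c : ℝˣ) (a : Rn n) : 𝓢(Rn n, ℂ) :=
  SchwartzMap.compSubConstCLM ℝ a
    (SchwartzMap.compCLMOfContinuousLinearEquiv ℝ
      (ContinuousLinearEquiv.smulLeft c : Rn n ≃L[ℝ] Rn n) B)

theorem affineComp_apply {n : ℕ} (B : 𝓢(Rn n, ℂ)) (c : ℝˣ) (a ξ : Rn n) :
    affineComp B c a ξ = B ((c : ℝ) • (ξ - a)) := by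
  simp [affineComp, Units.smul_def]

theorem fourier_affineComp {n : ℕ} (B : 𝓢(Rn n, ℂ)) (c : ℝˣ) (hc : 0 < (c : ℝ)) (a x : Rn n) :
    𝓕 (affineComp B c a) x = Complex.exp ((-2 * Real.pi * inner ℝ a x : ℝ) * Complex.I) *
      (((c : ℝ) ^ n)⁻¹ : ℝ) * 𝓕 B ((c : ℝ)⁻¹ • x) := by
  rw [SchwartzMap.fourier_coe, SchwartzMap.fourier_coe, Real.fourier_eq', Real.fourier_eq']
  simp only [affineComp_apply]
  set G : Rn n → ℂ := fun v =>
    Complex.exp (↑(-2 * Real.pi * inner ℝ v ((c : ℝ)⁻¹ • x)) * Complex.I) • B v with hG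
  have h1 : ∀ v : Rn n, Complex.exp (↑(-2 * Real.pi * inner ℝ v x) * Complex.I) •
      B ((c : ℝ) • (v - a)) =
      (fun w => Complex.exp ((-2 * Real.pi * inner ℝ a x : ℝ) * Complex.I) *
        G ((c : ℝ) • w)) (v - a) := by
    intro v
    simp only [hG, smul_eq_mul]
    rw [← mul_assoc, ← Complex.exp_add, ← add_mul, ← Complex.ofReal_add]
    congr 4
    rw [real_inner_smul_left, real_inner_smul_right, inner_sub_left]
    field_simp
    ring
  simp_rw [h1]
  rw [integral_sub_right_eq_self (fun w => Complex.exp ((-2 * Real.pi * inner ℝ a x : ℝ) *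
    Complex.I) * G ((c : ℝ) • w)) a, integral_const_mul, Measure.integral_comp_smul_of_nonneg
      volume G _ (hR := hc.le), Complex.real_smul]
  simp only [finrank_euclideanSpace, Fintype.card_fin]
  ring

theorem besselSymbol_smul {n : ℕ} (s : ℝ) {c : ℝ} (hc : 0 < c) (x : Rn n) :
    besselSymbol s (c • x) = ((c ^ s * scaledBracket c⁻¹ s x : ℝ) : ℂ) := by
  rw [besselSymbol, scaledBracket, norm_smul, Real.norm_of_nonneg hc.le]
  congr 1
  rw [show 1 + 4 * Real.pi ^ 2 * (c * ‖x‖) ^ 2 =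
    c ^ 2 * (c⁻¹ ^ 2 + 4 * Real.pi ^ 2 * ‖x‖ ^ 2) by field_simp,
    Real.mul_rpow (by positivity) (by positivity), ← Real.rpow_natCast, ← Real.rpow_mul hc.le]
  congr 2
  push_cast
  ring

/-- The scaling law `(I - Δ) ^ (s / 2) (B(c(· - a))) = c ^ s ((c⁻² - Δ) ^ (s / 2) B)(c(· - a))`. -/
theorem fourierMultiplier_affineComp {n : ℕ} (s : ℝ) (B : 𝓢(Rn n, ℂ)) (c : ℝˣ)
    (hc : 0 < (c : ℝ)) (a ξ : Rn n) :
    SchwartzMap.fourierMultiplierCLM ℂ (besselSymbol s) (affineComp B c a) ξ =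
      ((c : ℝ) ^ s : ℝ) * 𝓕⁻ (SchwartzMap.smulLeftCLM ℂ (scaledBracket (c : ℝ)⁻¹ s : Rn n → ℝ)
        (𝓕 B)) ((c : ℝ) • (ξ - a)) := by
  have hc' : 0 < (c : ℝ)⁻¹ := inv_pos.2 hc
  rw [SchwartzMap.fourierMultiplierCLM_apply, SchwartzMap.fourierInv_coe,
    SchwartzMap.fourierInv_coe, Real.fourierInv_eq', Real.fourierInv_eq']
  simp only [SchwartzMap.smulLeftCLM_apply_apply (hasTemperateGrowth_besselSymbol s),
    SchwartzMap.smulLeftCLM_apply_apply (hasTemperateGrowth_scaledBracket hc' s),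
    fourier_affineComp B c hc]
  set G : Rn n → ℂ := fun v =>
    Complex.exp (↑(2 * Real.pi * inner ℝ v ((c : ℝ) • (ξ - a))) * Complex.I) •
      scaledBracket (c : ℝ)⁻¹ s v • 𝓕 B v with hG
  have h1 : ∀ v : Rn n, Complex.exp (↑(2 * Real.pi * inner ℝ v ξ) * Complex.I) •
      besselSymbol s v • (Complex.exp ((-2 * Real.pi * inner ℝ a v : ℝ) * Complex.I) *
      (((c : ℝ) ^ n)⁻¹ : ℝ) * 𝓕 B ((c : ℝ)⁻¹ • v)) =
      ((((c : ℝ) ^ n)⁻¹ : ℝ) * ((c : ℝ) ^ s : ℝ)) * G ((c : ℝ)⁻¹ • v) := by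
    intro v
    have h2 : besselSymbol s v = besselSymbol s ((c : ℝ) • ((c : ℝ)⁻¹ • v)) := by
      rw [smul_inv_smul₀ hc.ne']
    rw [h2, besselSymbol_smul s hc]
    simp only [hG, smul_eq_mul, Complex.real_smul]
    have h3 : Complex.exp (↑(2 * Real.pi * inner ℝ ((c : ℝ)⁻¹ • v) ((c : ℝ) • (ξ - a))) *
        Complex.I) = Complex.exp (↑(2 * Real.pi * inner ℝ v ξ) * Complex.I) *
        Complex.exp ((-2 * Real.pi * inner ℝ a v : ℝ) * Complex.I) := by
      rw [← Complex.exp_add, ← add_mul, ← Complex.ofReal_add]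
      congr 3
      rw [real_inner_smul_left, real_inner_smul_right, inner_sub_right, real_inner_comm v a]
      field_simp
      ring
    rw [h3]
    push_cast
    ring
  simp_rw [h1]
  rw [integral_const_mul, Measure.integral_comp_smul_of_nonneg volume G _ (hR := hc'.le),
    Complex.real_smul]
  have hcn : ((c : ℝ) : ℂ) ≠ 0 := Complex.ofReal_ne_zero.2 hc.ne'
  simp only [finrank_euclideanSpace, Fintype.card_fin, inv_pow, inv_inv]
  push_cast
  field_simp

/-! ### Lacunary series -/

/-- The unit `2 ^ k` of `ℝ`. -/
noncomputable def twoPow (k : ℕ) : ℝˣ := Units.mk0 ((2 : ℝ) ^ k) (by positivity)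

theorem coe_twoPow (k : ℕ) : (twoPow k : ℝ) = 2 ^ k := rfl

/-- The coefficient `(k + 1) ^ (-κ) 2 ^ (-k ν)` of the lacunary multiplier. -/
noncomputable def lacunaryCoeff (κ ν : ℝ) (k : ℕ) : ℝ :=
  ((k : ℝ) + 1) ^ (-κ) * (2 : ℝ) ^ (-((k : ℝ) * ν))

theorem lacunaryCoeff_pos (κ ν : ℝ) (k : ℕ) : 0 < lacunaryCoeff κ ν k := by
  unfold lacunaryCoeff
  positivity

theorem lacunaryCoeff_le {κ ν : ℝ} (hκ : 0 ≤ κ) (k : ℕ) :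
    lacunaryCoeff κ ν k ≤ (2 : ℝ) ^ (-((k : ℝ) * ν)) := by
  refine mul_le_of_le_one_left (by positivity) ?_
  exact Real.rpow_le_one_of_one_le_of_nonpos (by simp) (by linarith)

/-- The profile of the sum of the series at distance `2 ^ i` from its centre: a logarithmically
damped power of order `-β` near the centre, and decay of order `-N` at infinity. -/
noncomputable def profile (κ β : ℝ) (N : ℕ) (i : ℤ) : ℝ :=
  if 0 ≤ i then (2 : ℝ) ^ (-((i : ℝ) * N)) else (1 - (i : ℝ)) ^ (-κ) * (2 : ℝ) ^ (-((i : ℝ) * β))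

theorem profile_pos (κ β : ℝ) (N : ℕ) (i : ℤ) : 0 < profile κ β N i := by
  unfold profile
  split_ifs with h
  · positivity
  · have : (i : ℝ) < 0 := by exact_mod_cast not_le.1 h
    have : 0 < 1 - (i : ℝ) := by linarith
    positivity

/-- The relative size of the `k`-th term at distance `2 ^ (-l)` is bounded in terms of `k - l` only,
by this two-sided summable sequence. -/
noncomputable def kernelWeight (n : ℕ) (κ β : ℝ) (j : ℤ) : ℝ :=
  if 0 ≤ j then (2 : ℝ) ^ ((j : ℝ) * (β - n)) else (1 - (j : ℝ)) ^ κ * (2 : ℝ) ^ ((j : ℝ) * β)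

theorem two_rpow_mul_eq_pow (l : ℕ) (x : ℝ) : (2 : ℝ) ^ ((l : ℝ) * x) = ((2 : ℝ) ^ x) ^ l := by
  rw [mul_comm, Real.rpow_mul two_pos.le, Real.rpow_natCast]

theorem summable_two_rpow {x : ℝ} (hx : x < 0) : Summable fun l : ℕ => (2 : ℝ) ^ ((l : ℝ) * x) := by
  simp_rw [two_rpow_mul_eq_pow]
  exact summable_geometric_of_lt_one (by positivity)
    (Real.rpow_lt_one_of_one_lt_of_neg one_lt_two hx)

theorem summable_rpow_mul_two_rpow (κ : ℝ) {x : ℝ} (hx : x < 0) :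
    Summable fun l : ℕ => ((l : ℝ) + 1) ^ κ * (2 : ℝ) ^ ((l : ℝ) * x) := by
  obtain ⟨K, hK⟩ := exists_nat_ge κ
  have h1 : ‖(2 : ℝ) ^ x‖ < 1 := by
    rw [Real.norm_of_nonneg (by positivity)]
    exact Real.rpow_lt_one_of_one_lt_of_neg one_lt_two hx
  have h2 : Summable fun l : ℕ => (((l + 1 : ℕ) : ℝ)) ^ K * ((2 : ℝ) ^ x) ^ (l + 1) :=
    (summable_nat_add_iff (f := fun l : ℕ => (l : ℝ) ^ K * ((2 : ℝ) ^ x) ^ l) 1).2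
      (summable_pow_mul_geometric_of_norm_lt_one K h1)
  refine Summable.of_nonneg_of_le (fun l => by positivity) (fun l => ?_)
    (h2.mul_right ((2 : ℝ) ^ x)⁻¹)
  rw [two_rpow_mul_eq_pow, pow_succ, mul_assoc, mul_assoc, mul_inv_cancel₀ (by positivity), mul_one]
  gcongr
  push_cast
  rw [← Real.rpow_natCast]
  exact Real.rpow_le_rpow_of_exponent_le (by simp) hK

theorem kernelWeight_nonneg (n : ℕ) (κ β : ℝ) (j : ℤ) : 0 ≤ kernelWeight n κ β j := by
  unfold kernelWeight
  split_ifs with h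
  · positivity
  · have : (j : ℝ) < 0 := by exact_mod_cast not_le.1 h
    have : 0 < 1 - (j : ℝ) := by linarith
    positivity

theorem summable_kernelWeight {n : ℕ} {κ β : ℝ} (hβ : 0 < β) (hβn : β < n) :
    Summable (kernelWeight n κ β) := by
  refine Summable.of_nat_of_neg ?_ ?_
  · refine (summable_two_rpow (sub_neg.2 hβn)).congr fun l => ?_
    simp [kernelWeight]
  · refine (summable_nat_add_iff 1).1 (((summable_nat_add_iff 1).2
      (summable_rpow_mul_two_rpow κ (neg_lt_zero.2 hβ))).congr fun l => ?_)
    rw [kernelWeight, if_neg (by push_cast; omega)]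
    push_cast
    congr 2
    · ring
    · ring

/-- A term of the series at distance `ρ ≥ 2 ^ (-l)` from the centre, where `X` is the size of
`(I - Δ) ^ (s / 2)` of the `k`-th bump. For `k ≥ l` the decay at scale `2 ^ (-k)` gains
`2 ^ (-(k - l) (n - β))`; for `k < l` the trivial bound gives `2 ^ (-(l - k) β)`, up to the ratio of
the logarithmic factors. -/
theorem lacunaryCoeff_mul_le {n : ℕ} {κ s β C X ρ : ℝ} (hκ : 0 ≤ κ) (hX : 0 ≤ X)
    {k l : ℕ} (hρ : (2 : ℝ) ^ (-(l : ℤ)) ≤ ρ) (h0 : X ≤ C * (2 : ℝ) ^ ((k : ℝ) * s))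
    (h1 : ((2 : ℝ) ^ k * ρ) ^ n * X ≤ C * (2 : ℝ) ^ ((k : ℝ) * s)) :
    lacunaryCoeff κ (s - β) k * X ≤
      C * (((l : ℝ) + 1) ^ (-κ) * (2 : ℝ) ^ ((l : ℝ) * β)) * kernelWeight n κ β (k - l) := by
  rcases le_or_gt l k with hlk | hlk
  · have h2 : ((2 : ℝ) ^ ((k : ℝ) - l)) ^ n * X ≤ C * (2 : ℝ) ^ ((k : ℝ) * s) := by
      refine le_trans ?_ h1
      gcongr
      rw [Real.rpow_sub two_pos, Real.rpow_natCast, Real.rpow_natCast, div_eq_mul_inv]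
      gcongr
      simpa using hρ
    have h3 : X ≤ C * (2 : ℝ) ^ ((k : ℝ) * s) * (2 : ℝ) ^ (-(((k : ℝ) - l) * n)) := by
      rw [Real.rpow_neg two_pos.le, ← div_eq_mul_inv, le_div_iff₀ (by positivity), mul_comm X,
        Real.rpow_mul two_pos.le, Real.rpow_natCast]
      exact h2
    have h4 : ((k : ℝ) + 1) ^ (-κ) ≤ ((l : ℝ) + 1) ^ (-κ) :=
      Real.rpow_le_rpow_of_nonpos (by positivity) (by gcongr) (by linarith)
    rw [kernelWeight, if_pos (by omega), lacunaryCoeff]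
    calc _ ≤ ((l : ℝ) + 1) ^ (-κ) * (2 : ℝ) ^ (-((k : ℝ) * (s - β))) *
          (C * (2 : ℝ) ^ ((k : ℝ) * s) * (2 : ℝ) ^ (-(((k : ℝ) - l) * n))) := by gcongr
      _ = C * ((l : ℝ) + 1) ^ (-κ) * ((2 : ℝ) ^ (-((k : ℝ) * (s - β))) *
          (2 : ℝ) ^ ((k : ℝ) * s) * (2 : ℝ) ^ (-(((k : ℝ) - l) * n))) := by ring
      _ = C * ((l : ℝ) + 1) ^ (-κ) * ((2 : ℝ) ^ ((l : ℝ) * β) *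
          (2 : ℝ) ^ ((((k : ℤ) - (l : ℤ) : ℤ) : ℝ) * (β - n))) := by
          rw [← Real.rpow_add two_pos, ← Real.rpow_add two_pos, ← Real.rpow_add two_pos]
          congr 2
          push_cast
          ring
      _ = _ := by ring
  · rw [kernelWeight, if_neg (by omega), lacunaryCoeff]
    have hkl : (k : ℝ) + 1 ≤ l := by exact_mod_cast hlk
    have hk0 : (0 : ℝ) ≤ k := Nat.cast_nonneg k
    have hpos : 0 < 1 - (((k : ℤ) - (l : ℤ) : ℤ) : ℝ) := by
      push_cast
      linarith
    have h4 : ((k : ℝ) + 1) ^ (-κ) ≤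
        ((l : ℝ) + 1) ^ (-κ) * (1 - (((k : ℤ) - (l : ℤ) : ℤ) : ℝ)) ^ κ := by
      push_cast at hpos ⊢
      rw [Real.rpow_neg (by positivity), Real.rpow_neg (by positivity), ← div_eq_inv_mul,
        inv_eq_one_div, div_le_div_iff₀ (by positivity) (by positivity), one_mul,
        ← Real.mul_rpow hpos.le (by positivity)]
      -- This is `l + 1 ≤ (1 + l - k) (k + 1)`.
      refine Real.rpow_le_rpow (by positivity) ?_ hκ
      nlinarith
    calc _ ≤ (((l : ℝ) + 1) ^ (-κ) * (1 - (((k : ℤ) - (l : ℤ) : ℤ) : ℝ)) ^ κ) *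
          (2 : ℝ) ^ (-((k : ℝ) * (s - β))) * (C * (2 : ℝ) ^ ((k : ℝ) * s)) := by gcongr
      _ = C * ((l : ℝ) + 1) ^ (-κ) * (1 - (((k : ℤ) - (l : ℤ) : ℤ) : ℝ)) ^ κ *
          ((2 : ℝ) ^ (-((k : ℝ) * (s - β))) * (2 : ℝ) ^ ((k : ℝ) * s)) := by ring
      _ = C * ((l : ℝ) + 1) ^ (-κ) * (1 - (((k : ℤ) - (l : ℤ) : ℤ) : ℝ)) ^ κ *
          ((2 : ℝ) ^ ((l : ℝ) * β) * (2 : ℝ) ^ ((((k : ℤ) - (l : ℤ) : ℤ) : ℝ) * β)) := by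
          rw [← Real.rpow_add two_pos, ← Real.rpow_add two_pos]
          congr 2
          push_cast
          ring
      _ = _ := by ring

/-- Summation of the rescaled bumps: `X k x` stands for the size of `(I - Δ) ^ (s / 2)` of the `k`-th
bump at the point `x`, at distance `ρ x` from the centre. -/
theorem exists_tsum_lacunary_le {n N : ℕ} {κ s β γ C : ℝ} (hκ : 0 ≤ κ) (hβ : 0 < β)
    (hβn : β < n) (hβs : β ≤ s) (hγ : 0 < γ) (hC : 0 ≤ C) {ι : Type*} (X : ℕ → ι → ℝ)
    (ρ : ι → ℝ) (hX : ∀ k x, 0 ≤ X k x)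
    (h0 : ∀ k x, X k x ≤ C * (2 : ℝ) ^ ((k : ℝ) * s))
    (h1 : ∀ k x, ((2 : ℝ) ^ k * ρ x) ^ n * X k x ≤ C * (2 : ℝ) ^ ((k : ℝ) * s))
    (h2 : ∀ k x, ρ x ^ N * X k x ≤ C * (2 : ℝ) ^ ((k : ℝ) * (-γ))) :
    ∃ K : ℝ, 0 < K ∧ ∀ (i : ℤ) (x : ι), (2 : ℝ) ^ i ≤ ρ x →
      ∑' k, ENNReal.ofReal (lacunaryCoeff κ (s - β) k * X k x) ≤
        ENNReal.ofReal (K * profile κ β N i) := by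
  have hEs := summable_kernelWeight (κ := κ) hβ hβn
  have hgs := summable_two_rpow (neg_lt_zero.2 hγ)
  set E := ∑' j, kernelWeight n κ β j
  set G := ∑' k : ℕ, (2 : ℝ) ^ ((k : ℝ) * (-γ))
  have hE0 : 0 ≤ E := tsum_nonneg fun j => kernelWeight_nonneg n κ β j
  have hG0 : 0 ≤ G := tsum_nonneg fun k => by positivity
  refine ⟨C * E + C * G + 1, by positivity, fun i x hx => ?_⟩
  rcases le_or_gt 0 i with hi | hi
  · have hb : ∀ k, lacunaryCoeff κ (s - β) k * X k x ≤
        (C * profile κ β N i) * (2 : ℝ) ^ ((k : ℝ) * (-γ)) := by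
      intro k
      have hρ : 0 < ρ x := lt_of_lt_of_le (by positivity) hx
      have h3 : lacunaryCoeff κ (s - β) k ≤ 1 := by
        refine (lacunaryCoeff_le hκ k).trans ?_
        refine Real.rpow_le_one_of_one_le_of_nonpos one_le_two ?_
        rw [neg_nonpos]
        exact mul_nonneg (Nat.cast_nonneg k) (by linarith)
      have h4 : (2 : ℝ) ^ ((i : ℝ) * N) * X k x ≤ C * (2 : ℝ) ^ ((k : ℝ) * (-γ)) := by
        refine le_trans ?_ (h2 k x)
        rw [Real.rpow_mul two_pos.le, Real.rpow_natCast, Real.rpow_intCast]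
        have := hX k x
        gcongr
      rw [profile, if_pos hi, Real.rpow_neg two_pos.le]
      calc _ ≤ 1 * X k x := mul_le_mul_of_nonneg_right h3 (hX k x)
        _ ≤ (C * (2 : ℝ) ^ ((k : ℝ) * (-γ))) / (2 : ℝ) ^ ((i : ℝ) * N) := by
            rw [one_mul, le_div_iff₀ (by positivity), mul_comm]
            exact h4
        _ = _ := by ring
    have hp := profile_pos κ β N i
    calc _ ≤ ∑' k : ℕ, ENNReal.ofReal ((C * profile κ β N i) * (2 : ℝ) ^ ((k : ℝ) * (-γ))) :=
          ENNReal.tsum_le_tsum fun k => ENNReal.ofReal_le_ofReal (hb k)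
      _ = ENNReal.ofReal ((C * profile κ β N i) * G) := by
          rw [← ENNReal.ofReal_tsum_of_nonneg (fun k => by positivity) (hgs.mul_left _),
            tsum_mul_left]
      _ ≤ _ := by
          refine ENNReal.ofReal_le_ofReal ?_
          rw [mul_right_comm]
          gcongr
          linarith [mul_nonneg hC hE0]
  · obtain ⟨l, rfl⟩ : ∃ l : ℕ, i = -(l : ℤ) := ⟨i.natAbs, by omega⟩
    have hpr : profile κ β N (-(l : ℤ)) = ((l : ℝ) + 1) ^ (-κ) * (2 : ℝ) ^ ((l : ℝ) * β) := by
      rw [profile, if_neg (by omega)]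
      push_cast
      congr 2
      · ring
      · ring
    have hp := profile_pos κ β N (-(l : ℤ))
    have hb : ∀ k, lacunaryCoeff κ (s - β) k * X k x ≤
        (C * profile κ β N (-(l : ℤ))) * kernelWeight n κ β (k - l) := by
      intro k
      rw [hpr]
      exact lacunaryCoeff_mul_le hκ (hX k x) hx (h0 k x) (h1 k x)
    calc _ ≤ ∑' k : ℕ, ENNReal.ofReal (C * profile κ β N (-(l : ℤ))) *
          ENNReal.ofReal (kernelWeight n κ β (k - l)) := by
          refine ENNReal.tsum_le_tsum fun k => ?_
          rw [← ENNReal.ofReal_mul (by positivity)]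
          exact ENNReal.ofReal_le_ofReal (hb k)
      _ = ENNReal.ofReal (C * profile κ β N (-(l : ℤ))) *
          ∑' k : ℕ, ENNReal.ofReal (kernelWeight n κ β (k - l)) := ENNReal.tsum_mul_left
      _ ≤ ENNReal.ofReal (C * profile κ β N (-(l : ℤ))) * ENNReal.ofReal E := by
          gcongr
          rw [ENNReal.ofReal_tsum_of_nonneg (kernelWeight_nonneg n κ β) hEs]
          refine ENNReal.tsum_comp_le_tsum_of_injective (f := fun k : ℕ => (k : ℤ) - l) ?_
            fun j => ENNReal.ofReal (kernelWeight n κ β j)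
          intro a b hab
          simpa using hab
      _ ≤ _ := by
          rw [← ENNReal.ofReal_mul (by positivity)]
          refine ENNReal.ofReal_le_ofReal ?_
          rw [mul_right_comm]
          gcongr
          linarith [mul_nonneg hC hG0]

/-- The dyadic form of membership in `L^{n/x,Q}`. In the critical case `β = x` the powers of two
cancel, and the logarithmic factor is summable because `κ Q > 1`. -/
theorem summable_profile {N : ℕ} {κ β x Q : ℝ} (hQ : 0 < Q) (hN : x < N)
    (hx : β < x ∨ β = x ∧ 1 < κ * Q) :
    Summable fun i : ℤ => (((2 : ℝ) ^ i) ^ x * profile κ β N i) ^ Q := by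
  refine Summable.of_nat_of_neg ?_ ?_
  · refine (summable_two_rpow (x := (x - N) * Q)
      (mul_neg_of_neg_of_pos (by linarith) hQ)).congr fun l => ?_
    rw [profile, if_pos (by omega), ← Real.rpow_intCast, ← Real.rpow_mul two_pos.le,
      ← Real.rpow_add two_pos, ← Real.rpow_mul two_pos.le]
    congr 1
    push_cast
    ring
  · have he : ∀ l : ℕ, (((2 : ℝ) ^ (-((l + 1 : ℕ) : ℤ))) ^ x *
        profile κ β N (-((l + 1 : ℕ) : ℤ))) ^ Q =
        (((l + 1 : ℕ) : ℝ) + 1) ^ (-(κ * Q)) * (2 : ℝ) ^ (((l + 1 : ℕ) : ℝ) * ((β - x) * Q)) := by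
      intro l
      rw [profile, if_neg (by push_cast; omega), ← Real.rpow_intCast, ← Real.rpow_mul two_pos.le,
        mul_left_comm, ← Real.rpow_add two_pos]
      have h1 : (0 : ℝ) ≤ 1 - ((-((l + 1 : ℕ) : ℤ) : ℤ) : ℝ) := by push_cast; linarith
      rw [Real.mul_rpow (by positivity) (by positivity), ← Real.rpow_mul h1,
        ← Real.rpow_mul two_pos.le]
      push_cast
      congr 2
      · ring
      · ring
      · ring
    refine (summable_nat_add_iff 1).1 ?_
    simp_rw [he]
    refine (summable_nat_add_iff (f := fun l : ℕ => ((l : ℝ) + 1) ^ (-(κ * Q)) *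
      (2 : ℝ) ^ ((l : ℝ) * ((β - x) * Q))) 1).2 ?_
    rcases hx with hx | ⟨rfl, hx⟩
    · exact summable_rpow_mul_two_rpow _ (mul_neg_of_neg_of_pos (by linarith) hQ)
    · have := (summable_nat_add_iff 1).2 (Real.summable_nat_rpow.2 (neg_lt_neg hx))
      refine this.congr fun l => ?_
      simp

theorem rpow_mul_profile_le {N : ℕ} {κ β x : ℝ} (hκ : 0 ≤ κ) (hN : x ≤ N) (hx : β ≤ x) (i : ℤ) :
    ((2 : ℝ) ^ i) ^ x * profile κ β N i ≤ 1 := by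
  rw [profile, ← Real.rpow_intCast, ← Real.rpow_mul two_pos.le]
  split_ifs with h
  · rw [← Real.rpow_add two_pos]
    refine Real.rpow_le_one_of_one_le_of_nonpos one_le_two ?_
    have : (0 : ℝ) ≤ i := by exact_mod_cast h
    nlinarith
  · have hi : (i : ℝ) < 0 := by exact_mod_cast not_le.1 h
    rw [mul_left_comm, ← Real.rpow_add two_pos]
    refine mul_le_one₀ ?_ (by positivity) ?_
    · exact Real.rpow_le_one_of_one_le_of_nonpos (by linarith) (by linarith)
    · exact Real.rpow_le_one_of_one_le_of_nonpos one_le_two (by nlinarith)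

/-! ### Lorentz-Sobolev norms of lacunary series -/

/-- The `k`-th bump `ξ ↦ χ ξ θ (2 ^ k (ξ - a))` of the lacunary multiplier, localised by `χ`. -/
noncomputable def bump {n : ℕ} (χ θ : 𝓢(Rn n, ℂ)) (a : Rn n) (k : ℕ) : 𝓢(Rn n, ℂ) :=
  affineComp (windowed χ θ a ((2 : ℝ) ^ k)⁻¹) (twoPow k) a

theorem bump_apply {n : ℕ} (χ θ : 𝓢(Rn n, ℂ)) (a : Rn n) (k : ℕ) (ξ : Rn n) :
    bump χ θ a k ξ = χ ξ * θ ((2 : ℝ) ^ k • (ξ - a)) := by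
  rw [bump, affineComp_apply, windowed_apply, coe_twoPow, inv_smul_smul₀ (by positivity)]
  simp

/-- Decay of `(I - Δ) ^ (s / 2)` of the `k`-th bump at its natural scale `2 ^ (-k)`, with the loss of
`2 ^ (k (N - s - γ))` once `N > s + γ`. -/
theorem exists_fourierMultiplier_bump_le {n : ℕ} (hn : 0 < n) {s γ : ℝ} (hs : 0 ≤ s)
    (hγ0 : 0 ≤ γ) (hγ : γ < n) (χ θ : 𝓢(Rn n, ℂ)) (a : Rn n) (N : ℕ) :
    ∃ C : ℝ, 0 ≤ C ∧ ∀ k ξ, ((2 : ℝ) ^ k * ‖ξ - a‖) ^ N *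
      ‖SchwartzMap.fourierMultiplierCLM ℂ (besselSymbol s) (bump χ θ a k) ξ‖ ≤
        C * (2 : ℝ) ^ ((k : ℝ) * (s + max (N - s - γ) 0)) := by
  obtain ⟨C, hC, h⟩ := exists_decay_scaledBracket hn hs hγ0 hγ
    ((isVonNBounded_windowed χ θ).image (fourierCLM ℂ 𝓢(Rn n, ℂ))) N
  refine ⟨C, hC, fun k ξ => ?_⟩
  have hk : (0 : ℝ) < 2 ^ k := by positivity
  have hk1 : ((2 : ℝ) ^ k)⁻¹ ≤ 1 := inv_le_one_of_one_le₀ (one_le_pow₀ one_le_two)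
  have h' := h (𝓕 (windowed χ θ a ((2 : ℝ) ^ k)⁻¹))
    ⟨_, ⟨a, _, by rwa [abs_of_pos (inv_pos.2 hk)], rfl⟩, rfl⟩
    ((2 : ℝ) ^ k)⁻¹ (inv_pos.2 hk) hk1 ((2 : ℝ) ^ k • (ξ - a))
  rw [norm_smul, Real.norm_of_nonneg hk.le] at h'
  rw [bump, fourierMultiplier_affineComp s _ _ (by rw [coe_twoPow]; positivity), coe_twoPow,
    norm_mul, Complex.norm_real, Real.norm_of_nonneg (by positivity), mul_left_comm]
  calc _ ≤ ((2 : ℝ) ^ k) ^ s * (C * (((2 : ℝ) ^ k)⁻¹) ^ (-(max (N - s - γ) 0))) := by gcongr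
    _ = _ := by
      rw [Real.inv_rpow hk.le, Real.rpow_neg hk.le, inv_inv, mul_left_comm, ← Real.rpow_add hk,
        Real.rpow_mul two_pos.le, Real.rpow_natCast]

theorem lintegral_tsum_bump_lt_top {n : ℕ} (hn : 0 < n) {κ ν : ℝ} (hκ : 0 ≤ κ) (hν : 0 ≤ ν)
    (χ θ : 𝓢(Rn n, ℂ)) (a : Rn n) :
    ∫⁻ ξ, ∑' k, ‖((lacunaryCoeff κ ν k : ℝ) : ℂ) * bump χ θ a k ξ‖ₑ < ∞ := by
  rw [lintegral_tsum fun k => by fun_prop]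
  set K := SchwartzMap.seminorm ℂ 0 0 χ * ∫ ξ, ‖θ ξ‖ with hK
  have hb : ∀ k, ∫⁻ ξ, ‖((lacunaryCoeff κ ν k : ℝ) : ℂ) * bump χ θ a k ξ‖ₑ ≤
      ENNReal.ofReal (K * (2 : ℝ) ^ ((k : ℝ) * (-(n : ℝ)))) := by
    intro k
    have hk : (0 : ℝ) < 2 ^ k := by positivity
    have hint : Integrable fun ξ => ‖θ ((2 : ℝ) ^ k • (ξ - a))‖ :=
      ((affineComp θ (twoPow k) a).integrable.norm).congr
        (Filter.Eventually.of_forall fun ξ => by simp only [affineComp_apply, coe_twoPow])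
    calc _ ≤ ∫⁻ ξ, ENNReal.ofReal (SchwartzMap.seminorm ℂ 0 0 χ *
          ‖θ ((2 : ℝ) ^ k • (ξ - a))‖) := by
          refine lintegral_mono fun ξ => ?_
          rw [← ofReal_norm]
          refine ENNReal.ofReal_le_ofReal ?_
          rw [bump_apply, norm_mul, norm_mul, Complex.norm_real,
            Real.norm_of_nonneg (lacunaryCoeff_pos κ ν k).le]
          have h1 : lacunaryCoeff κ ν k ≤ 1 := by
            refine (lacunaryCoeff_le hκ k).trans
              (Real.rpow_le_one_of_one_le_of_nonpos one_le_two ?_)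
            rw [neg_nonpos]
            positivity
          calc _ ≤ 1 * (‖χ ξ‖ * ‖θ ((2 : ℝ) ^ k • (ξ - a))‖) := by gcongr
            _ ≤ _ := by
              rw [one_mul]
              gcongr
              exact χ.norm_le_seminorm ℂ ξ
      _ = _ := by
          rw [← ofReal_integral_eq_lintegral_ofReal (hint.const_mul _)
            (Filter.Eventually.of_forall fun ξ => by positivity), integral_const_mul,
            integral_sub_right_eq_self (fun ξ => ‖θ ((2 : ℝ) ^ k • ξ)‖) a,
            Measure.integral_comp_smul_of_nonneg volume (fun ξ => ‖θ ξ‖) _ (hR := hk.le), hK]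
          congr 1
          rw [two_rpow_mul_eq_pow, Real.rpow_neg two_pos.le, Real.rpow_natCast]
          simp only [finrank_euclideanSpace, Fintype.card_fin, smul_eq_mul]
          rw [inv_pow, ← pow_mul, ← pow_mul, mul_comm n k]
          ring
  refine (ENNReal.tsum_le_tsum hb).trans_lt ?_
  exact ((summable_two_rpow (by simpa using hn)).mul_left K).tsum_ofReal_lt_top

/-- The lacunary series with coefficients `(k + 1) ^ (-κ) 2 ^ (-k (s - β))` has finite
`L^{r,q}_s` norm when `n / r > β`, and also for `n / r = β` when `κ q > 1`. -/
theorem lorentzSobolevNormFun_lacunary_lt_top {n : ℕ} (hn : 0 < n) {s β κ r : ℝ} {q : ℝ≥0∞}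
    (hs : 0 < s) (hβ : 0 < β) (hβn : β < n) (hβs : β ≤ s) (hκ : 0 ≤ κ) (hr : 0 < r) (hq : 0 < q)
    (h : β < n / r ∨ β = n / r ∧ (q = ∞ ∨ 1 < κ * q.toReal))
    (χ θ : 𝓢(Rn n, ℂ)) (a : Rn n) :
    lorentzSobolevNormFun s r q (fun ξ => ∑' k,
      ((lacunaryCoeff κ (s - β) k : ℝ) : ℂ) * (χ ξ * θ ((2 : ℝ) ^ k • (ξ - a)))) < ∞ := by
  have hn' : (0 : ℝ) < n := by exact_mod_cast hn
  -- `γ < n` keeps `‖x‖ ^ (-γ)` locally integrable, and `γ ≥ n - s` makes decay of order `n` free of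
  -- losses in `k`.
  set γ : ℝ := n - min s n / 2 with hγ
  have hmin : 0 < min s (n : ℝ) := lt_min hs hn'
  have hγn : γ < n := by linarith
  have hγ0 : 0 < γ := by linarith [min_le_right s (n : ℝ)]
  have hsγ : (n : ℝ) - s - γ ≤ 0 := by linarith [min_le_left s (n : ℝ)]
  -- Decay of order `N` gives summability in `k` far from the centre and integrability at infinity.
  obtain ⟨N, hN⟩ := exists_nat_gt (max (s + γ) (max (n / r) n))
  have hN1 : s + γ < N := (le_max_left _ _).trans_lt hN
  have hN2 : n / r < N := ((le_max_left _ _).trans (le_max_right _ _)).trans_lt hN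
  have hN3 : (n : ℝ) < N := ((le_max_right _ _).trans (le_max_right _ _)).trans_lt hN
  obtain ⟨C0, hC0, h0⟩ := exists_fourierMultiplier_bump_le hn hs.le hγ0.le hγn χ θ a 0
  obtain ⟨C1, hC1, h1⟩ := exists_fourierMultiplier_bump_le hn hs.le hγ0.le hγn χ θ a n
  obtain ⟨C2, hC2, h2⟩ := exists_fourierMultiplier_bump_le hn hs.le hγ0.le hγn χ θ a N
  set F : ℕ → 𝓢(Rn n, ℂ) := fun k =>
    SchwartzMap.fourierMultiplierCLM ℂ (besselSymbol s) (bump χ θ a k) with hF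
  obtain ⟨K, hK, hKb⟩ := exists_tsum_lacunary_le (C := C0 + C1 + C2) (N := N) (γ := γ) hκ hβ hβn
    hβs hγ0 (by positivity) (fun k ξ => ‖F k ξ‖) (fun ξ => ‖ξ - a‖) (fun k ξ => norm_nonneg _)
    (by
      intro k ξ
      have := h0 k ξ
      rw [pow_zero, one_mul, max_eq_right (by push_cast; linarith), add_zero] at this
      refine this.trans ?_
      gcongr
      linarith)
    (by
      intro k ξ
      have := h1 k ξ
      rw [max_eq_right hsγ, add_zero] at this
      refine this.trans ?_
      gcongr
      linarith)
    (by
      intro k ξ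
      have := h2 k ξ
      rw [max_eq_left (by linarith), mul_pow, mul_assoc, ← pow_mul, ← Real.rpow_natCast,
        show (k : ℝ) * (s + (N - s - γ)) = ((k * N : ℕ) : ℝ) + (k : ℝ) * (-γ) by push_cast; ring,
        Real.rpow_add two_pos, mul_left_comm C2] at this
      refine (le_of_mul_le_mul_left this (by positivity)).trans ?_
      gcongr
      linarith)
  set f : ℕ → 𝓢(Rn n, ℂ) := fun k => ((lacunaryCoeff κ (s - β) k : ℝ) : ℂ) • bump χ θ a k with hf
  set A : ℤ → ℝ := fun i => K * profile κ β N i with hA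
  have hA0 : ∀ i, 0 < A i := fun i => mul_pos hK (profile_pos _ _ _ _)
  have hfF : ∀ k ξ, SchwartzMap.fourierMultiplierCLM ℂ (besselSymbol s) (f k) ξ =
      ((lacunaryCoeff κ (s - β) k : ℝ) : ℂ) * F k ξ := by
    intro k ξ
    simp only [hf, hF, map_smul, smul_apply, smul_eq_mul]
  have hbd : ∀ (i : ℤ) (ξ : Rn n), (2 : ℝ) ^ i ≤ ‖ξ - a‖ →
      ∑' k, ‖SchwartzMap.fourierMultiplierCLM ℂ (besselSymbol s) (f k) ξ‖ₑ ≤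
        ENNReal.ofReal (A i) := by
    intro i ξ hi
    refine le_trans (le_of_eq (tsum_congr fun k => ?_)) (hKb i ξ hi)
    rw [hfF, ← ofReal_norm, norm_mul, Complex.norm_real,
      Real.norm_of_nonneg (lacunaryCoeff_pos _ _ k).le]
  have hL1F : ∫⁻ ξ, ∑' k, ‖SchwartzMap.fourierMultiplierCLM ℂ (besselSymbol s) (f k) ξ‖ₑ < ∞ := by
    refine lintegral_lt_top_of_dyadic hn (fun i => (hA0 i).le) hbd ?_
    have := (summable_profile (κ := κ) (Q := 1) one_pos hN3 (Or.inl hβn)).mul_left K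
    refine this.congr fun i => ?_
    rw [Real.rpow_one, Real.rpow_natCast]
    simp only [hA]
    ring
  have hL1f : ∫⁻ ξ, ∑' k, ‖f k ξ‖ₑ < ∞ :=
    lintegral_tsum_bump_lt_top hn hκ (sub_nonneg.2 hβs) χ θ a
  have hmain := lorentzSobolevNormFun_tsum_le s r q f hL1f hL1F
  have heq : (fun ξ => ∑' k, ((lacunaryCoeff κ (s - β) k : ℝ) : ℂ) *
      (χ ξ * θ ((2 : ℝ) ^ k • (ξ - a)))) = fun ξ => ∑' k, f k ξ := by
    funext ξ
    refine tsum_congr fun k => ?_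
    simp only [hf, smul_apply, smul_eq_mul, bump_apply]
  rw [heq]
  refine hmain.trans_lt ?_
  have hg : ∀ (i : ℤ) (ξ : Rn n), (2 : ℝ) ^ i ≤ ‖ξ - a‖ →
      ‖∑' k, SchwartzMap.fourierMultiplierCLM ℂ (besselSymbol s) (f k) ξ‖ ≤ A i := by
    intro i ξ hi
    have := enorm_tsum_le_tsum_enorm.trans (hbd i ξ hi)
    rwa [← ofReal_norm, ENNReal.ofReal_le_ofReal_iff (hA0 i).le] at this
  have hβr : β ≤ n / r := h.elim le_of_lt fun h => h.1.le
  by_cases hqt : q = ∞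
  · subst hqt
    refine lorentzNorm_top_lt_top hn hA0 hg hr (M := K) fun i => ?_
    rw [hA, mul_left_comm]
    exact mul_le_of_le_one_right hK.le (rpow_mul_profile_le hκ hN2.le hβr i)
  · refine lorentzNorm_lt_top hn hA0 hg hr hq hqt ?_
    have hq' : 0 < q.toReal := ENNReal.toReal_pos hq.ne' hqt
    have := (summable_profile (κ := κ) hq' hN2 (h.imp_right fun h =>
      ⟨h.1, h.2.resolve_left hqt⟩)).mul_left (K ^ q.toReal)
    refine this.congr fun i => ?_
    rw [hA, mul_left_comm, Real.mul_rpow hK.le]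
    have := profile_pos κ β N i
    positivity

/-! ### Bump functions -/

/-- A smooth bump, as a complex Schwartz function. -/
noncomputable def bumpSchwartz {n : ℕ} (b : ContDiffBump (0 : Rn n)) : 𝓢(Rn n, ℂ) :=
  HasCompactSupport.toSchwartzMap (f := fun x => ((b x : ℝ) : ℂ))
    (b.hasCompactSupport.comp_left (g := fun y : ℝ => (y : ℂ)) Complex.ofReal_zero)
    (Complex.ofRealCLM.contDiff.comp b.contDiff)

theorem bumpSchwartz_apply {n : ℕ} (b : ContDiffBump (0 : Rn n)) (x : Rn n) :
    bumpSchwartz b x = ((b x : ℝ) : ℂ) := rfl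

theorem exists_cutoff (n : ℕ) : ∃ (φ : 𝓢(Rn n, ℂ)) (φr : Rn n → ℝ), (∀ x, φ x = φr x) ∧
    (∀ x, 0 ≤ φr x) ∧ (∀ x, ‖x‖ ≤ 1 / 2 → φr x = 1) ∧ ∀ x, φr x ≠ 0 → ‖x‖ < 3 / 4 := by
  let b : ContDiffBump (0 : Rn n) := ⟨1 / 2, 3 / 4, by norm_num, by norm_num⟩
  refine ⟨bumpSchwartz b, b, fun x => rfl, fun x => b.nonneg,
    fun x hx => b.one_of_mem_closedBall (by simpa [b] using hx), fun x hx => ?_⟩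
  by_contra h
  exact hx (b.zero_of_le_dist (by simpa [b] using h))

/-- The Fourier transform of a bump is real, since `ContDiffBump` is even. -/
theorem fourier_bumpSchwartz_eq_ofReal {n : ℕ} (b : ContDiffBump (0 : Rn n)) (x : Rn n) :
    𝓕 (bumpSchwartz b) x = (((𝓕 (bumpSchwartz b) x).re : ℝ) : ℂ) := by
  refine (Complex.conj_eq_iff_re.1 ?_).symm
  have h1 : 𝓕 (bumpSchwartz b) x = 𝓕⁻ (bumpSchwartz b : Rn n → ℂ) x := by
    rw [Real.fourierInv_eq_fourier_comp_neg, SchwartzMap.fourier_coe]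
    refine congrArg (fun g : Rn n → ℂ => 𝓕 g x) (funext fun y => ?_)
    rw [bumpSchwartz_apply, bumpSchwartz_apply, b.neg]
  conv_lhs => rw [SchwartzMap.fourier_coe, Real.fourier_eq', ← integral_conj]
  rw [h1, Real.fourierInv_eq']
  refine integral_congr_ae (Filter.Eventually.of_forall fun v => ?_)
  simp only [smul_eq_mul, map_mul, ← Complex.exp_conj, Complex.conj_ofReal, Complex.conj_I,
    bumpSchwartz_apply]
  congr 2
  push_cast
  ring

/-- There is a nonnegative bump function with nonnegative inverse Fourier transform: the
convolution square of an even bump. -/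
theorem exists_positive_bump (n : ℕ) : ∃ (θ : 𝓢(Rn n, ℂ)) (θr t : Rn n → ℝ) (c₀ ρ₀ : ℝ),
    0 < c₀ ∧ 0 < ρ₀ ∧ ρ₀ ≤ 1 / 2 ∧
    (∀ x, θ x = θr x) ∧ (∀ x, 0 ≤ θr x) ∧ (∀ x, ‖x‖ ≤ ρ₀ → c₀ ≤ θr x) ∧
    (∀ x, θ x ≠ 0 → ‖x‖ < 1 / 2) ∧
    (∀ x, 𝓕⁻ θ x = t x) ∧ (∀ x, 0 ≤ t x) ∧ ∀ x, ‖x‖ ≤ ρ₀ → c₀ ≤ t x := by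
  let b : ContDiffBump (0 : Rn n) := ⟨1 / 8, 1 / 4, by norm_num, by norm_num⟩
  set η := bumpSchwartz b with hη
  set θ := SchwartzMap.convolution (ContinuousLinearMap.mul ℂ ℂ) η η with hθ
  have hbi : Integrable fun v => b v * b v :=
    (b.continuous.mul b.continuous).integrable_of_hasCompactSupport b.hasCompactSupport.mul_left
  have hpos : 0 < ∫ v, b v := b.integral_pos
  have hθx : ∀ x, θ x = ((∫ v, b v * b (x - v) : ℝ) : ℂ) := by
    intro x
    rw [hθ, SchwartzMap.convolution_apply, convolution_def, ← integral_complex_ofReal]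
    simp [hη, bumpSchwartz_apply]
  have hF : ∀ x, 𝓕⁻ θ x = (((𝓕 η (-x)).re ^ 2 : ℝ) : ℂ) := by
    intro x
    have h1 : 𝓕⁻ θ x = 𝓕 θ (-x) := by
      rw [SchwartzMap.fourierInv_coe, Real.fourierInv_eq_fourier_neg, SchwartzMap.fourier_coe]
    rw [h1, hθ, SchwartzMap.fourier_convolution, SchwartzMap.pairing_apply_apply,
      ContinuousLinearMap.mul_apply', hη]
    conv_lhs => rw [fourier_bumpSchwartz_eq_ofReal b]
    push_cast
    ring
  have hθ0 : 0 < ∫ v, b v * b (0 - v) := by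
    simp only [zero_sub, b.neg]
    rw [integral_pos_iff_support_of_nonneg (fun v => mul_self_nonneg _) hbi]
    have : Function.support (fun v => b v * b v) = Metric.ball (0 : Rn n) (1 / 4) := by
      rw [← show Function.support b = Metric.ball (0 : Rn n) (1 / 4) from b.support_eq]
      ext v
      simp
    rw [this]
    exact Metric.measure_ball_pos _ _ (by norm_num)
  have hF0 : 0 < (𝓕 η (-0)).re ^ 2 := by
    have : 𝓕 η (-0 : Rn n) = ((∫ v, b v : ℝ) : ℂ) := by
      rw [SchwartzMap.fourier_coe, Real.fourier_eq', ← integral_complex_ofReal]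
      simp [hη, bumpSchwartz_apply]
    rw [this, Complex.ofReal_re]
    positivity
  set θr : Rn n → ℝ := fun x => ∫ v, b v * b (x - v)
  set t : Rn n → ℝ := fun x => (𝓕 η (-x)).re ^ 2
  have hcθ : Continuous θr := by
    have : θr = fun x => (θ x).re := by
      funext x
      rw [hθx, Complex.ofReal_re]
    rw [this]
    fun_prop
  have hct : Continuous t := by fun_prop
  have h1 : ∀ᶠ x in nhds (0 : Rn n), θr 0 / 2 < θr x :=
    hcθ.continuousAt.eventually_const_lt (half_lt_self hθ0)
  have h2 : ∀ᶠ x in nhds (0 : Rn n), t 0 / 2 < t x :=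
    hct.continuousAt.eventually_const_lt (half_lt_self hF0)
  obtain ⟨ρ, hρ, hb⟩ := Metric.eventually_nhds_iff.1 (h1.and h2)
  have key : ∀ x : Rn n, ‖x‖ ≤ min (ρ / 2) (1 / 2) → dist x 0 < ρ := by
    intro x hx
    rw [dist_zero_right]
    linarith [hx.trans (min_le_left _ _)]
  refine ⟨θ, θr, t, min (θr 0 / 2) (t 0 / 2), min (ρ / 2) (1 / 2), lt_min (half_pos hθ0)
    (half_pos hF0), by positivity, min_le_right _ _, hθx,
    fun x => integral_nonneg fun v => mul_nonneg b.nonneg b.nonneg,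
    fun x hx => (min_le_left _ _).trans (hb (key x hx)).1.le, fun x hx => ?_, hF,
    fun x => sq_nonneg _, fun x hx => (min_le_right _ _).trans (hb (key x hx)).2.le⟩
  by_contra hlt
  refine hx ?_
  rw [hθx]
  norm_cast
  refine integral_eq_zero_of_ae (Filter.Eventually.of_forall fun v => ?_)
  rcases le_or_gt (1 / 4) ‖v‖ with hv | hv
  · change b v * b (x - v) = 0
    rw [b.zero_of_le_dist (by simpa [b] using hv), zero_mul]
  · have : (1 / 4 : ℝ) ≤ ‖x - v‖ := by linarith [norm_sub_norm_le x v, not_lt.1 hlt]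
    change b v * b (x - v) = 0
    rw [b.zero_of_le_dist (x := x - v) (by simpa [b] using this), mul_zero]

/-! ### Hardy norms -/

/-- The Hardy norm dominates the `L^p` norm of a bounded continuous function, because
`Φ_k * K → K` pointwise as `k → ∞`. -/
theorem lintegral_rpow_le_hardyNorm {n : ℕ} {Φ : 𝓢(Rn n, ℂ)} (hΦ : ∫ x, Φ x = 1) {p : ℝ}
    (hp : 0 < p) {K : Rn n → ℂ} (hKc : Continuous K) {M : ℝ} (hKM : ∀ x, ‖K x‖ ≤ M)
    {u : 𝓢'(Rn n, ℂ)} (hu : RepresentedBy u K) :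
    (∫⁻ x, ‖K x‖ₑ ^ p) ^ (1 / p) ≤ hardyNorm Φ p u := by
  unfold hardyNorm
  gcongr with x
  have h1 : ∀ k : ℕ, u (dilatedKernel Φ k x) =
      ∫ z, Φ z * K (x - ((2 : ℝ) ^ k)⁻¹ • z) := by
    intro k
    have hk : (0 : ℝ) < 2 ^ k := by positivity
    rw [(hu.2 _).2]
    simp only [dilatedKernel_apply]
    set G : Rn n → ℂ := fun z => Φ z * K (x - ((2 : ℝ) ^ k)⁻¹ • z) with hG
    have h2 : ∀ y, ((2 : ℝ) ^ ((k : ℤ) * (n : ℤ)) • Φ ((2 : ℝ) ^ (k : ℤ) • (x - y))) * K y =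
        (fun w => (2 : ℝ) ^ ((k : ℤ) * (n : ℤ)) • G ((2 : ℝ) ^ k • w)) (x - y) := by
      intro y
      simp only [hG, zpow_natCast, inv_smul_smul₀ hk.ne', sub_sub_cancel, smul_mul_assoc]
    simp_rw [h2]
    rw [integral_sub_left_eq_self (fun w => (2 : ℝ) ^ ((k : ℤ) * (n : ℤ)) • G ((2 : ℝ) ^ k • w)),
      integral_smul, Measure.integral_comp_smul_of_nonneg volume G _ (hR := hk.le), smul_smul]
    simp only [finrank_euclideanSpace, Fintype.card_fin]
    rw [zpow_mul, zpow_natCast, zpow_natCast, mul_inv_cancel₀ (by positivity), one_smul]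
  have h2 : Filter.Tendsto (fun k : ℕ => u (dilatedKernel Φ k x)) Filter.atTop (nhds (K x)) := by
    simp_rw [h1]
    have h3 : K x = ∫ z, Φ z * K x := by rw [integral_mul_const, hΦ, one_mul]
    rw [h3]
    refine tendsto_integral_of_dominated_convergence (fun z => ‖Φ z‖ * M)
      (fun k => by fun_prop) (Φ.integrable.norm.mul_const M)
      (fun k => Filter.Eventually.of_forall fun z => ?_)
      (Filter.Eventually.of_forall fun z => ?_)
    · rw [norm_mul]
      gcongr
      exact hKM _
    · refine Filter.Tendsto.const_mul _ ((hKc.tendsto x).comp ?_)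
      have h4 : Filter.Tendsto (fun k : ℕ => ((2 : ℝ) ^ k)⁻¹) Filter.atTop (nhds 0) := by
        simp_rw [← inv_pow]
        exact tendsto_pow_atTop_nhds_zero_of_lt_one (by norm_num) (by norm_num)
      simpa using (h4.smul_const z).const_sub x
  refine le_of_tendsto h2.enorm (Filter.Eventually.of_forall fun k => ?_)
  exact le_iSup (fun k : ℤ => ‖u (dilatedKernel Φ k x)‖ₑ) (k : ℤ)

/-- `Φ_k * f` has Fourier transform `Φ̂(2 ^ (-k) ·) f̂`; here `f` is given by its Fourier transform
`A`. -/
theorem toTemperedDistribution_dilatedKernel {n : ℕ} (Φ A : 𝓢(Rn n, ℂ)) (k : ℤ) (x : Rn n) :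
    SchwartzMap.toTemperedDistributionCLM (Rn n) ℂ volume (𝓕⁻ A) (dilatedKernel Φ k x) =
      ∫ ξ, Complex.exp ((2 * Real.pi * inner ℝ ξ x : ℝ) * Complex.I) *
        (𝓕 Φ ((2 : ℝ) ^ (-k) • ξ) * A ξ) := by
  have hk : (0 : ℝ) < 2 ^ k := by positivity
  refine (SchwartzMap.toTemperedDistributionCLM_apply_apply volume _ _).trans ?_
  simp only [smul_eq_mul]
  rw [← SchwartzMap.integral_fourierInv_mul_eq]
  refine integral_congr_ae (Filter.Eventually.of_forall fun ξ => ?_)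
  simp only
  rw [← mul_assoc]
  congr 1
  rw [SchwartzMap.fourierInv_coe, Real.fourierInv_eq', SchwartzMap.fourier_coe, Real.fourier_eq']
  simp only [dilatedKernel_apply]
  set G : Rn n → ℂ := fun v =>
    Complex.exp (↑(-2 * Real.pi * inner ℝ v ((2 : ℝ) ^ (-k) • ξ)) * Complex.I) • Φ v with hG
  have h2 : ∀ y, Complex.exp (↑(2 * Real.pi * inner ℝ y ξ) * Complex.I) •
      ((2 : ℝ) ^ (k * (n : ℤ)) • Φ ((2 : ℝ) ^ k • (x - y))) =
      (fun w => (Complex.exp ((2 * Real.pi * inner ℝ ξ x : ℝ) * Complex.I) *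
        ((2 : ℝ) ^ (k * (n : ℤ)) : ℝ)) * G ((2 : ℝ) ^ k • w)) (x - y) := by
    intro y
    simp only [hG, smul_eq_mul, Complex.real_smul]
    have h3 : Complex.exp (↑(2 * Real.pi * inner ℝ y ξ) * Complex.I) =
        Complex.exp ((2 * Real.pi * inner ℝ ξ x : ℝ) * Complex.I) * Complex.exp
          (↑(-2 * Real.pi * inner ℝ ((2 : ℝ) ^ k • (x - y)) ((2 : ℝ) ^ (-k) • ξ)) *
            Complex.I) := by
      rw [← Complex.exp_add, ← add_mul, ← Complex.ofReal_add]
      congr 3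
      rw [real_inner_smul_left, real_inner_smul_right, inner_sub_left, real_inner_comm x ξ,
        zpow_neg]
      field_simp
      ring
    rw [h3]
    ring
  simp_rw [h2]
  rw [integral_sub_left_eq_self (fun w => (Complex.exp ((2 * Real.pi * inner ℝ ξ x : ℝ) *
      Complex.I) * ((2 : ℝ) ^ (k * (n : ℤ)) : ℝ)) * G ((2 : ℝ) ^ k • w)), integral_const_mul,
    Measure.integral_comp_smul_of_nonneg volume G _ (hR := hk.le), mul_assoc, Complex.real_smul,
    ← mul_assoc ((_ : ℝ) : ℂ), ← Complex.ofReal_mul]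
  simp only [finrank_euclideanSpace, Fintype.card_fin]
  rw [zpow_mul, zpow_natCast, mul_inv_cancel₀ (by positivity), Complex.ofReal_one, one_mul]

/-- The test function whose Fourier transform is `φ (2 ^ l (ξ - a))`: a wave of frequency `a` in a
window of size `2 ^ l`. -/
noncomputable def testFunction {n : ℕ} (φ : 𝓢(Rn n, ℂ)) (a : Rn n) (l : ℕ) : 𝓢(Rn n, ℂ) :=
  𝓕⁻ (affineComp φ (twoPow l) a)

theorem fourier_testFunction {n : ℕ} (φ : 𝓢(Rn n, ℂ)) (a : Rn n) (l : ℕ) (ξ : Rn n) :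
    𝓕 (testFunction φ a l) ξ = φ ((2 : ℝ) ^ l • (ξ - a)) := by
  rw [testFunction, FourierTransform.fourier_fourierInv_eq, affineComp_apply, coe_twoPow]

/-- The convolutions of the test function with all dilates of `Φ` satisfy a uniform decay
estimate at the scale `2 ^ l`. -/
theorem exists_norm_testFunction_dilatedKernel_le {n : ℕ} {Φ φ : 𝓢(Rn n, ℂ)}
    (hΦ : ∀ ξ, 𝓕 Φ ξ ≠ 0 → ‖ξ‖ ≤ 2) {a : Rn n} (ha : ‖a‖ = 2)
    (hφ : ∀ ξ, φ ξ ≠ 0 → ‖ξ‖ < 3 / 4) (M : ℕ) :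
    ∃ C : ℝ, 0 ≤ C ∧ ∀ (l : ℕ) (k : ℤ) (x : Rn n),
      ‖SchwartzMap.toTemperedDistributionCLM (Rn n) ℂ volume (testFunction φ a l)
        (dilatedKernel Φ k x)‖ ≤
        C * (((2 : ℝ) ^ l)⁻¹ ^ n * ((1 + ‖((2 : ℝ) ^ l)⁻¹ • x‖) ^ M)⁻¹) := by
  obtain ⟨C, hC, h⟩ := exists_pow_mul_norm_iteratedFDeriv_le
    ((isVonNBounded_windowed (𝓕 Φ) φ).image (fourierCLM ℂ 𝓢(Rn n, ℂ))) M 0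
  refine ⟨C, hC, fun l k x => ?_⟩
  rw [testFunction, toTemperedDistribution_dilatedKernel]
  have hl : (1 : ℝ) ≤ 2 ^ l := one_le_pow₀ one_le_two
  have hl0 : (0 : ℝ) < 2 ^ l := by positivity
  rcases lt_or_ge k 0 with hk | hk
  -- For `k < 0` the spectra of `Φ_k` and of the test function are disjoint.
  · have h0 : ∀ ξ : Rn n, 𝓕 Φ ((2 : ℝ) ^ (-k) • ξ) * affineComp φ (twoPow l) a ξ = 0 := by
      intro ξ
      by_contra hne
      obtain ⟨h1, h2⟩ := mul_ne_zero_iff.1 hne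
      have h3 := hΦ _ h1
      rw [affineComp_apply, coe_twoPow] at h2
      have h4 := hφ _ h2
      rw [norm_smul, Real.norm_of_nonneg (by positivity)] at h3 h4
      have h5 : ‖ξ - a‖ < 3 / 4 := by
        refine lt_of_le_of_lt ?_ h4
        exact le_mul_of_one_le_left (norm_nonneg _) hl
      have h6 : ‖a‖ ≤ ‖ξ‖ + ‖ξ - a‖ := by
        have := norm_sub_le ξ (ξ - a)
        rwa [sub_sub_cancel] at this
      have h7 : (2 : ℝ) ≤ (2 : ℝ) ^ (-k) := by
        calc (2 : ℝ) = (2 : ℝ) ^ (1 : ℤ) := (zpow_one _).symm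
          _ ≤ _ := zpow_le_zpow_right₀ one_le_two (by omega)
      nlinarith [norm_nonneg ξ]
    simp only [h0, mul_zero, integral_zero, norm_zero]
    positivity
  -- For `k ≥ 0` the product of the spectra is a rescaled member of a bounded family.
  · set δ : ℝ := (2 : ℝ) ^ (-k) * ((2 : ℝ) ^ l)⁻¹ with hδ
    set B := windowed (𝓕 Φ) φ ((2 : ℝ) ^ (-k) • a) δ with hB
    have h1 : ∀ ξ : Rn n, 𝓕 Φ ((2 : ℝ) ^ (-k) • ξ) * affineComp φ (twoPow l) a ξ =
        affineComp B (twoPow l) a ξ := by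
      intro ξ
      rw [affineComp_apply, affineComp_apply, hB, windowed_apply, coe_twoPow, hδ, smul_smul,
        mul_assoc, inv_mul_cancel₀ hl0.ne', mul_one, ← smul_add, add_sub_cancel]
    have h2 : ∫ ξ, Complex.exp ((2 * Real.pi * inner ℝ ξ x : ℝ) * Complex.I) *
        affineComp B (twoPow l) a ξ = 𝓕 (affineComp B (twoPow l) a) (-x) := by
      rw [SchwartzMap.fourier_coe, ← Real.fourierInv_eq_fourier_neg, Real.fourierInv_eq']
      simp only [smul_eq_mul]
    simp_rw [h1]
    rw [h2, fourier_affineComp B _ (by rw [coe_twoPow]; positivity), norm_mul, norm_mul,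
      Complex.norm_exp_ofReal_mul_I, one_mul, Complex.norm_real, coe_twoPow,
      Real.norm_of_nonneg (by positivity), inv_pow, mul_left_comm]
    gcongr
    have hδ1 : |δ| ≤ 1 := by
      rw [abs_of_nonneg (by positivity)]
      exact mul_le_one₀ (zpow_le_one_of_nonpos₀ one_le_two (by omega)) (by positivity)
        (inv_le_one_of_one_le₀ hl)
    have h3 := h (𝓕 B) ⟨B, ⟨_, δ, hδ1, rfl⟩, rfl⟩ (((2 : ℝ) ^ l)⁻¹ • (-x))
    rw [norm_iteratedFDeriv_zero] at h3
    rw [← div_eq_mul_inv, le_div_iff₀ (by positivity), mul_comm]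
    rwa [smul_neg, norm_neg, ← smul_neg] at h3

/-- The Hardy norm of the test function is at most comparable to its `L^p` norm: its size is
`2 ^ (-l n)` on a ball of radius `2 ^ l`. -/
theorem exists_hardyNorm_testFunction_le {n : ℕ} {Φ φ : 𝓢(Rn n, ℂ)}
    (hΦ : ∀ ξ, 𝓕 Φ ξ ≠ 0 → ‖ξ‖ ≤ 2) {a : Rn n} (ha : ‖a‖ = 2)
    (hφ : ∀ ξ, φ ξ ≠ 0 → ‖ξ‖ < 3 / 4) {p : ℝ} (hp : 0 < p) :
    ∃ C : ℝ, 0 ≤ C ∧ ∀ l : ℕ,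
      hardyNorm Φ p
        (SchwartzMap.toTemperedDistributionCLM (Rn n) ℂ volume (testFunction φ a l)) ≤
        ENNReal.ofReal (C * (((2 : ℝ) ^ l)⁻¹ ^ n * (((2 : ℝ) ^ l) ^ n) ^ (1 / p))) := by
  obtain ⟨M, hM⟩ := exists_nat_gt (n / p)
  rw [div_lt_iff₀ hp] at hM
  obtain ⟨C, hC, h⟩ := exists_norm_testFunction_dilatedKernel_le hΦ ha hφ M
  have hJ : Integrable fun x : Rn n => (1 + ‖x‖) ^ (-((M : ℝ) * p)) :=
    integrable_one_add_norm (by simpa using hM)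
  obtain ⟨J, hJdef⟩ : ∃ J, J = ∫ x : Rn n, (1 + ‖x‖) ^ (-((M : ℝ) * p)) := ⟨_, rfl⟩
  have hJ0 : 0 ≤ J := hJdef ▸ integral_nonneg fun x => by positivity
  refine ⟨C * J ^ (1 / p), by positivity, fun l => ?_⟩
  have hl : (0 : ℝ) < 2 ^ l := by positivity
  set D : ℝ := C * ((2 : ℝ) ^ l)⁻¹ ^ n with hD
  have hD0 : 0 ≤ D := by positivity
  have hint : Integrable fun x : Rn n =>
      D ^ p * (1 + ‖((2 : ℝ) ^ l)⁻¹ • x‖) ^ (-((M : ℝ) * p)) :=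
    (hJ.comp_smul (inv_ne_zero hl.ne')).const_mul _
  calc hardyNorm Φ p _ ≤ (∫⁻ x : Rn n, ENNReal.ofReal
        (D ^ p * (1 + ‖((2 : ℝ) ^ l)⁻¹ • x‖) ^ (-((M : ℝ) * p)))) ^ (1 / p) := by
        unfold hardyNorm
        gcongr with x
        calc _ ≤ (ENNReal.ofReal (D * ((1 + ‖((2 : ℝ) ^ l)⁻¹ • x‖) ^ M)⁻¹)) ^ p := by
              gcongr
              refine iSup_le fun k => ?_
              rw [← ofReal_norm]
              refine ENNReal.ofReal_le_ofReal ((h l k x).trans (le_of_eq ?_))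
              rw [hD]
              ring
          _ = _ := by
              rw [ENNReal.ofReal_rpow_of_nonneg (by positivity) hp.le,
                Real.mul_rpow hD0 (by positivity), Real.inv_rpow (by positivity),
                Real.rpow_neg (by positivity), Real.rpow_mul (by positivity), Real.rpow_natCast]
    _ = (ENNReal.ofReal (D ^ p * (((2 : ℝ) ^ l) ^ n * J))) ^ (1 / p) := by
        rw [← ofReal_integral_eq_lintegral_ofReal hint
          (Filter.Eventually.of_forall fun x => by positivity), integral_const_mul,
          Measure.integral_comp_smul_of_nonneg volume
            (fun x : Rn n => (1 + ‖x‖) ^ (-((M : ℝ) * p))) _ (hR := by positivity)]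
        simp [hJdef]
    _ = _ := by
        rw [ENNReal.ofReal_rpow_of_nonneg (by positivity) (by positivity),
          Real.mul_rpow (by positivity) (by positivity), ← Real.rpow_mul hD0,
          mul_one_div_cancel hp.ne', Real.rpow_one, Real.mul_rpow (by positivity) hJ0, hD]
        congr 1
        ring

/-! ### The lacunary multiplier -/

/-- The multiplier `∑ (k + 1) ^ (-κ) 2 ^ (-k ν) θ (2 ^ k (ξ - a))`. For compactly supported `θ` the
sum is finite unless `ξ = a`, where it takes the value `0` if the series diverges. -/
noncomputable def lacunaryMultiplier {n : ℕ} (θ : 𝓢(Rn n, ℂ)) (a : Rn n) (κ ν : ℝ) (ξ : Rn n) :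
    ℂ :=
  ∑' k, ((lacunaryCoeff κ ν k : ℝ) : ℂ) * θ ((2 : ℝ) ^ k • (ξ - a))

theorem norm_sub_lt_of_bump_ne_zero {n : ℕ} {θ : 𝓢(Rn n, ℂ)} {a ξ : Rn n}
    (hθ : ∀ x, θ x ≠ 0 → ‖x‖ < 1 / 2) {k : ℕ} (h : θ ((2 : ℝ) ^ k • (ξ - a)) ≠ 0) :
    ‖ξ - a‖ < 1 / 2 := by
  have h1 := hθ _ h
  rw [norm_smul, Real.norm_of_nonneg (by positivity)] at h1
  exact (le_mul_of_one_le_left (norm_nonneg _) (one_le_pow₀ one_le_two)).trans_lt h1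

theorem lacunaryMultiplier_eq_zero {n : ℕ} {θ : 𝓢(Rn n, ℂ)} {a ξ : Rn n} {κ ν : ℝ}
    (hθ : ∀ x, θ x ≠ 0 → ‖x‖ < 1 / 2) (h : 1 / 2 ≤ ‖ξ - a‖) :
    lacunaryMultiplier θ a κ ν ξ = 0 := by
  rw [lacunaryMultiplier, ← tsum_zero (α := ℂ) (β := ℕ)]
  refine tsum_congr fun k => ?_
  by_contra hne
  exact absurd (norm_sub_lt_of_bump_ne_zero hθ (right_ne_zero_of_mul hne)) (not_lt.2 h)

theorem lintegral_tsum_lacunary_lt_top {n : ℕ} (hn : 0 < n) {θ : 𝓢(Rn n, ℂ)} (a : Rn n)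
    {κ ν : ℝ} (hκ : 0 ≤ κ) (hν : 0 ≤ ν) (hθ : ∀ x, θ x ≠ 0 → ‖x‖ < 1 / 2) :
    ∫⁻ ξ, ∑' k, ‖((lacunaryCoeff κ ν k : ℝ) : ℂ) * θ ((2 : ℝ) ^ k • (ξ - a))‖ₑ < ∞ := by
  obtain ⟨φ, φr, hφ, -, hφ1, -⟩ := exists_cutoff n
  refine lt_of_eq_of_lt ?_
    (lintegral_tsum_bump_lt_top hn hκ hν (affineComp φ (twoPow 0) a) θ a)
  refine lintegral_congr fun ξ => tsum_congr fun k => ?_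
  rw [bump_apply, affineComp_apply, coe_twoPow, pow_zero, one_smul]
  by_cases h : θ ((2 : ℝ) ^ k • (ξ - a)) = 0
  · simp [h]
  · rw [hφ, hφ1 _ (norm_sub_lt_of_bump_ne_zero hθ h).le, Complex.ofReal_one, one_mul]

theorem integrable_lacunaryMultiplier {n : ℕ} (hn : 0 < n) {θ : 𝓢(Rn n, ℂ)} (a : Rn n)
    {κ ν : ℝ} (hκ : 0 ≤ κ) (hν : 0 ≤ ν) (hθ : ∀ x, θ x ≠ 0 → ‖x‖ < 1 / 2) :
    Integrable (lacunaryMultiplier θ a κ ν) :=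
  integrable_tsum_of_lintegral (fun k => by fun_prop)
    (lintegral_tsum_lacunary_lt_top hn a hκ hν hθ)

theorem exists_norm_lacunaryMultiplier_le {n : ℕ} (θ : 𝓢(Rn n, ℂ)) (a : Rn n)
    {κ ν : ℝ} (hκ : 0 ≤ κ) (hν : 0 < ν) : ∃ M : ℝ, ∀ ξ, ‖lacunaryMultiplier θ a κ ν ξ‖ ≤ M := by
  have hs := (summable_two_rpow (neg_lt_zero.2 hν)).mul_right (SchwartzMap.seminorm ℂ 0 0 θ)
  refine ⟨_, fun ξ => tsum_of_norm_bounded hs.hasSum fun k => ?_⟩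
  rw [norm_mul, Complex.norm_real, Real.norm_of_nonneg (lacunaryCoeff_pos _ _ _).le, mul_neg]
  have := lacunaryCoeff_le (ν := ν) hκ k
  gcongr
  exact θ.norm_le_seminorm ℂ _

/-- Only the three dyadic pieces meeting the ball of radius `1 / 2` around `a` are nonzero, and
each of them is again a lacunary series. -/
theorem hormanderSup_lacunaryMultiplier_lt_top {n : ℕ} (hn : 0 < n) {s β κ r : ℝ} {q : ℝ≥0∞}
    (hs : 0 < s) (hβ : 0 < β) (hβn : β < n) (hβs : β ≤ s) (hκ : 0 ≤ κ) (hr : 0 < r) (hq : 0 < q)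
    (h : β < n / r ∨ β = n / r ∧ (q = ∞ ∨ 1 < κ * q.toReal))
    {Ψ : 𝓢(Rn n, ℂ)} (hΨ : ∀ ξ, 𝓕 Ψ ξ ≠ 0 → 1 / 2 < ‖ξ‖ ∧ ‖ξ‖ < 2)
    {θ : 𝓢(Rn n, ℂ)} (hθ : ∀ x, θ x ≠ 0 → ‖x‖ < 1 / 2) {a : Rn n} (ha : ‖a‖ = 2) :
    hormanderSup Ψ s r q (lacunaryMultiplier θ a κ (s - β)) < ∞ := by
  have key := fun χ θ' a' =>
    lorentzSobolevNormFun_lacunary_lt_top hn hs hβ hβn hβs hκ hr hq h χ θ' a'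
  set v : ℤ → ℝ≥0∞ := fun j => lorentzSobolevNormFun s r q
    (fun ξ => lacunaryMultiplier θ a κ (s - β) ((2 : ℝ) ^ j • ξ) * 𝓕 Ψ ξ) with hv
  have hfin : ∀ j, v j < ∞ := by
    intro j
    have hj : (0 : ℝ) < 2 ^ j := by positivity
    convert key (𝓕 Ψ) (affineComp θ (Units.mk0 ((2 : ℝ) ^ j) hj.ne') 0) (((2 : ℝ) ^ j)⁻¹ • a)
      using 3 with ξ
    rw [lacunaryMultiplier, ← tsum_mul_right]
    refine tsum_congr fun k => ?_
    have hsub : (2 : ℝ) ^ j • (ξ - ((2 : ℝ) ^ j)⁻¹ • a) = (2 : ℝ) ^ j • ξ - a := by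
      rw [smul_sub, smul_inv_smul₀ hj.ne']
    rw [affineComp_apply, Units.val_mk0, sub_zero, smul_comm ((2 : ℝ) ^ j), hsub]
    ring
  -- The multiplier lives on `3 / 2 < ‖ξ‖ < 5 / 2`, so `3 / 4 < 2 ^ j < 5` whenever its dilate meets
  -- the support of `Ψ̂`.
  have hzero : ∀ j, j ∉ ({0, 1, 2} : Finset ℤ) →
      v j = lorentzSobolevNormFun s r q (fun _ : Rn n => (0 : ℂ)) := by
    intro j hj
    simp only [hv]
    congr 1
    funext ξ
    by_contra hne
    obtain ⟨h1, h2⟩ := mul_ne_zero_iff.1 hne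
    obtain ⟨h3, h4⟩ := hΨ ξ h2
    have h5 : ‖(2 : ℝ) ^ j • ξ - a‖ < 1 / 2 := by
      by_contra hle
      exact h1 (lacunaryMultiplier_eq_zero hθ (not_lt.1 hle))
    have h6 : ‖(2 : ℝ) ^ j • ξ‖ = (2 : ℝ) ^ j * ‖ξ‖ := by
      rw [norm_smul, Real.norm_of_nonneg (by positivity)]
    have h7 := norm_sub_norm_le ((2 : ℝ) ^ j • ξ) a
    have h8 := norm_sub_norm_le a ((2 : ℝ) ^ j • ξ)
    rw [norm_sub_rev] at h8
    simp only [Finset.mem_insert, Finset.mem_singleton] at hj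
    rcases (by omega : j ≤ -1 ∨ 3 ≤ j) with hj' | hj'
    · have : (2 : ℝ) ^ j ≤ (2 : ℝ) ^ (-1 : ℤ) := zpow_le_zpow_right₀ one_le_two hj'
      norm_num at this
      nlinarith
    · have : (2 : ℝ) ^ (3 : ℤ) ≤ (2 : ℝ) ^ j := zpow_le_zpow_right₀ one_le_two hj'
      norm_num at this
      nlinarith
  have hz : lorentzSobolevNormFun s r q (fun _ : Rn n => (0 : ℂ)) < ∞ := by
    simpa using key 0 0 0
  have hbound : hormanderSup Ψ s r q (lacunaryMultiplier θ a κ (s - β)) ≤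
      (∑ j ∈ ({0, 1, 2} : Finset ℤ), v j) +
        lorentzSobolevNormFun s r q (fun _ : Rn n => (0 : ℂ)) := by
    refine iSup_le fun j => ?_
    by_cases hj : j ∈ ({0, 1, 2} : Finset ℤ)
    · exact (Finset.single_le_sum (f := v) (fun _ _ => bot_le) hj).trans le_self_add
    · exact (hzero j hj).le.trans le_add_self
  exact hbound.trans_lt (ENNReal.add_lt_top.2 ⟨ENNReal.sum_lt_top.2 fun j _ => hfin j, hz⟩)

/-! ### Unboundedness -/

theorem norm_exp_two_pi_inner {n : ℕ} (x ξ : Rn n) :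
    ‖Complex.exp (2 * Real.pi * Complex.I * (inner ℝ x ξ : ℝ))‖ = 1 := by
  rw [show 2 * (Real.pi : ℂ) * Complex.I * ((inner ℝ x ξ : ℝ) : ℂ) =
    ((2 * Real.pi * inner ℝ x ξ : ℝ) : ℂ) * Complex.I by push_cast; ring,
    Complex.norm_exp_ofReal_mul_I]

/-- Boundedness on `H^p` gives an `L^p` bound for `T_σ f`, which is a bounded continuous
function. -/
theorem IsBoundedOnHardy.exists_lintegral_le {n : ℕ} {Φ : 𝓢(Rn n, ℂ)} (hΦ : ∫ x, Φ x = 1) {p : ℝ}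
    (hp : 0 < p) {σ : Rn n → ℂ} (hσ : Integrable σ) (h : IsBoundedOnHardy Φ p σ) :
    ∃ C : ℝ≥0, ∀ f : 𝓢(Rn n, ℂ),
      hardyNorm Φ p (SchwartzMap.toTemperedDistributionCLM (Rn n) ℂ volume f) < ∞ →
      (∫⁻ x, ‖multiplierOp σ f x‖ₑ ^ p) ^ (1 / p) ≤
        C * hardyNorm Φ p (SchwartzMap.toTemperedDistributionCLM (Rn n) ℂ volume f) := by
  obtain ⟨C, hC⟩ := h
  refine ⟨C, fun f hf => ?_⟩
  have hint : Integrable fun ξ => σ ξ * 𝓕 f ξ :=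
    (hσ.mul_bdd (c := SchwartzMap.seminorm ℂ 0 0 (𝓕 f)) (𝓕 f).continuous.aestronglyMeasurable
      (Filter.Eventually.of_forall fun ξ => (𝓕 f).norm_le_seminorm ℂ ξ) :)
  have hcont : Continuous (multiplierOp σ f) := by
    refine continuous_of_dominated (bound := fun ξ => ‖σ ξ * 𝓕 f ξ‖) (fun x => ?_) (fun x => ?_)
      hint.norm ?_
    · exact hint.1.mul (by fun_prop)
    · refine Filter.Eventually.of_forall fun ξ => ?_
      rw [norm_mul _ (Complex.exp _), norm_exp_two_pi_inner, mul_one]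
    · exact Filter.Eventually.of_forall fun ξ => by fun_prop
  have hbd : ∀ x, ‖multiplierOp σ f x‖ ≤ ∫ ξ, ‖σ ξ * 𝓕 f ξ‖ := by
    intro x
    refine (norm_integral_le_integral_norm _).trans (le_of_eq ?_)
    refine integral_congr_ae (Filter.Eventually.of_forall fun ξ => ?_)
    simp only
    rw [norm_mul _ (Complex.exp _), norm_exp_two_pi_inner, mul_one]
  obtain ⟨u, hu⟩ := exists_representedBy le_top (memLp_top_of_bound
    hcont.aestronglyMeasurable _ (Filter.Eventually.of_forall hbd))
  exact (lintegral_rpow_le_hardyNorm hΦ hp hcont hbd hu).trans (hC f u hf hu)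

/-- The cutoff `φ` is one on the support of the multiplier, so that the inverse Fourier transform of
the multiplier comes out. -/
theorem multiplierOp_lacunary_testFunction {n : ℕ} (hn : 0 < n) {θ φ : 𝓢(Rn n, ℂ)}
    {t : Rn n → ℝ} {a : Rn n} {κ ν : ℝ} (hκ : 0 ≤ κ) (hν : 0 ≤ ν)
    (hθ : ∀ x, θ x ≠ 0 → ‖x‖ < 1 / 2) (ht : ∀ x, 𝓕⁻ θ x = t x)
    (hφ : ∀ x, ‖x‖ ≤ 1 / 2 → φ x = 1) (x : Rn n) :
    multiplierOp (lacunaryMultiplier θ a κ ν) (testFunction φ a 0) x =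
      Complex.exp ((2 * Real.pi * inner ℝ a x : ℝ) * Complex.I) *
        ∑' k, ((lacunaryCoeff κ ν k * (((2 : ℝ) ^ k) ^ n)⁻¹ * t (((2 : ℝ) ^ k)⁻¹ • x) : ℝ) : ℂ) := by
  have h1 : ∀ ξ, lacunaryMultiplier θ a κ ν ξ * 𝓕 (testFunction φ a 0) ξ *
      Complex.exp (2 * Real.pi * Complex.I * (inner ℝ x ξ : ℝ)) =
      ∑' k, ((lacunaryCoeff κ ν k : ℝ) : ℂ) * θ ((2 : ℝ) ^ k • (ξ - a)) *
        Complex.exp (2 * Real.pi * Complex.I * (inner ℝ x ξ : ℝ)) := by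
    intro ξ
    rw [tsum_mul_right, ← lacunaryMultiplier, fourier_testFunction, pow_zero, one_smul]
    rcases le_or_gt (1 / 2) ‖ξ - a‖ with h | h
    · rw [lacunaryMultiplier_eq_zero hθ h]
      simp
    · rw [hφ _ h.le, mul_one]
  rw [multiplierOp]
  simp_rw [h1]
  have hL := lintegral_tsum_lacunary_lt_top hn a hκ hν hθ
  rw [lintegral_tsum fun k => by fun_prop] at hL
  rw [integral_tsum (fun k => by fun_prop) ?_]
  swap
  · refine ne_of_eq_of_ne (tsum_congr fun k => lintegral_congr fun ξ => ?_) hL.ne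
    rw [enorm_mul _ (Complex.exp _), ← ofReal_norm (Complex.exp _), norm_exp_two_pi_inner,
      ENNReal.ofReal_one, mul_one]
  rw [← tsum_mul_left]
  refine tsum_congr fun k => ?_
  have h2 : ∫ ξ, θ ((2 : ℝ) ^ k • (ξ - a)) *
      Complex.exp (2 * Real.pi * Complex.I * (inner ℝ x ξ : ℝ)) =
      𝓕 (affineComp θ (twoPow k) a) (-x) := by
    rw [SchwartzMap.fourier_coe, Real.fourier_eq']
    refine integral_congr_ae (Filter.Eventually.of_forall fun ξ => ?_)
    simp only [affineComp_apply, coe_twoPow, smul_eq_mul]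
    rw [mul_comm, real_inner_comm]
    congr 2
    rw [inner_neg_right, real_inner_comm]
    push_cast
    ring
  have h3 : 𝓕 θ (((2 : ℝ) ^ k)⁻¹ • (-x)) = t (((2 : ℝ) ^ k)⁻¹ • x) := by
    rw [← ht, SchwartzMap.fourierInv_coe, Real.fourierInv_eq_fourier_neg, smul_neg,
      SchwartzMap.fourier_coe]
  have h4 : ∀ ξ, ((lacunaryCoeff κ ν k : ℝ) : ℂ) * θ ((2 : ℝ) ^ k • (ξ - a)) *
      Complex.exp (2 * Real.pi * Complex.I * (inner ℝ x ξ : ℝ)) =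
      ((lacunaryCoeff κ ν k : ℝ) : ℂ) * (θ ((2 : ℝ) ^ k • (ξ - a)) *
        Complex.exp (2 * Real.pi * Complex.I * (inner ℝ x ξ : ℝ))) := fun ξ => mul_assoc _ _ _
  rw [integral_congr_ae (Filter.Eventually.of_forall h4), integral_const_mul, h2, fourier_affineComp θ _ (by rw [coe_twoPow]; positivity), coe_twoPow,
    h3, inner_neg_right]
  push_cast
  rw [show -2 * (Real.pi : ℂ) * -((inner ℝ a x : ℝ) : ℂ) = 2 * Real.pi * (inner ℝ a x : ℝ) by ring]
  ring

/-- All terms are nonnegative, so a single one is a lower bound. -/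
theorem le_norm_multiplierOp_lacunary_testFunction {n : ℕ} (hn : 0 < n) {θ φ : 𝓢(Rn n, ℂ)}
    {t : Rn n → ℝ} {a : Rn n} {κ ν c₀ ρ₀ : ℝ} (hκ : 0 ≤ κ) (hν : 0 ≤ ν)
    (hθ : ∀ x, θ x ≠ 0 → ‖x‖ < 1 / 2) (ht : ∀ x, 𝓕⁻ θ x = t x) (ht0 : ∀ x, 0 ≤ t x)
    (htc : ∀ x, ‖x‖ ≤ ρ₀ → c₀ ≤ t x) (hφ : ∀ x, ‖x‖ ≤ 1 / 2 → φ x = 1) (l : ℕ) {x : Rn n}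
    (hx : ‖x‖ ≤ ρ₀ * 2 ^ l) :
    lacunaryCoeff κ ν l * (((2 : ℝ) ^ l) ^ n)⁻¹ * c₀ ≤
      ‖multiplierOp (lacunaryMultiplier θ a κ ν) (testFunction φ a 0) x‖ := by
  have hpos : ∀ k : ℕ, 0 ≤ lacunaryCoeff κ ν k * (((2 : ℝ) ^ k) ^ n)⁻¹ *
      t (((2 : ℝ) ^ k)⁻¹ • x) := fun k =>
    mul_nonneg (mul_nonneg (lacunaryCoeff_pos _ _ _).le (by positivity)) (ht0 _)
  have hs : Summable fun k : ℕ => lacunaryCoeff κ ν k * (((2 : ℝ) ^ k) ^ n)⁻¹ *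
      t (((2 : ℝ) ^ k)⁻¹ • x) := by
    refine Summable.of_nonneg_of_le hpos (fun k => ?_) ((summable_two_rpow (x := -(n : ℝ))
      (by simpa using hn)).mul_right (SchwartzMap.seminorm ℂ 0 0 (𝓕⁻ θ)))
    have h1 : t (((2 : ℝ) ^ k)⁻¹ • x) ≤ SchwartzMap.seminorm ℂ 0 0 (𝓕⁻ θ) := by
      have := (𝓕⁻ θ).norm_le_seminorm ℂ (((2 : ℝ) ^ k)⁻¹ • x)
      rw [ht, Complex.norm_real, Real.norm_of_nonneg (ht0 _)] at this
      exact this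
    have h2 : lacunaryCoeff κ ν k ≤ 1 := by
      refine (lacunaryCoeff_le hκ k).trans
        (Real.rpow_le_one_of_one_le_of_nonpos one_le_two ?_)
      rw [neg_nonpos]
      positivity
    have h3 : (((2 : ℝ) ^ k) ^ n)⁻¹ = (2 : ℝ) ^ ((k : ℝ) * (-(n : ℝ))) := by
      rw [two_rpow_mul_eq_pow, Real.rpow_neg two_pos.le, Real.rpow_natCast, inv_pow, ← pow_mul,
        ← pow_mul, mul_comm]
    rw [h3]
    have := ht0 (((2 : ℝ) ^ k)⁻¹ • x)
    have h4 : lacunaryCoeff κ ν k * (2 : ℝ) ^ ((k : ℝ) * (-(n : ℝ))) ≤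
        (2 : ℝ) ^ ((k : ℝ) * (-(n : ℝ))) := mul_le_of_le_one_left (by positivity) h2
    gcongr
  rw [multiplierOp_lacunary_testFunction hn hκ hν hθ ht hφ, norm_mul,
    Complex.norm_exp_ofReal_mul_I, one_mul, ← Complex.ofReal_tsum, Complex.norm_real,
    Real.norm_of_nonneg (tsum_nonneg hpos)]
  refine le_trans ?_ (hs.le_tsum l fun k _ => hpos k)
  have := lacunaryCoeff_pos κ ν l
  gcongr
  refine htc _ ?_
  rw [norm_smul, Real.norm_of_nonneg (by positivity), inv_mul_le_iff₀ (by positivity)]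
  linarith

/-- For `p ≤ 1` the kernel of the lacunary multiplier is not in `L^p`: the dyadic annulus of radius
`ρ₀ 2 ^ l` contributes at least a multiple of `1 / (l + 1)` to the integral. -/
theorem lintegral_multiplierOp_lacunary_eq_top {n : ℕ} (hn : 0 < n) {θ φ : 𝓢(Rn n, ℂ)}
    {t : Rn n → ℝ} {a : Rn n} (ha : ‖a‖ = 2) {p c₀ ρ₀ : ℝ} (hp : 0 < p) (hp1 : p ≤ 1)
    (hc : 0 < c₀) (hρ : 0 < ρ₀)
    (hθ : ∀ x, θ x ≠ 0 → ‖x‖ < 1 / 2) (ht : ∀ x, 𝓕⁻ θ x = t x) (ht0 : ∀ x, 0 ≤ t x)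
    (htc : ∀ x, ‖x‖ ≤ ρ₀ → c₀ ≤ t x) (hφ : ∀ x, ‖x‖ ≤ 1 / 2 → φ x = 1) :
    ∫⁻ x, ‖multiplierOp (lacunaryMultiplier θ a (1 / p) (n / p - n)) (testFunction φ a 0) x‖ₑ ^ p =
      ∞ := by
  set F : Rn n → ℝ≥0∞ := fun x =>
    ‖multiplierOp (lacunaryMultiplier θ a (1 / p) (n / p - n)) (testFunction φ a 0) x‖ₑ ^ p with hF
  set S : ℕ → Set (Rn n) := fun l => {x | ρ₀ * 2 ^ l / 2 < ‖x‖ ∧ ‖x‖ ≤ ρ₀ * 2 ^ l} with hS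
  have hSm : ∀ l, MeasurableSet (S l) := fun l =>
    (measurableSet_lt measurable_const measurable_norm).inter
      (measurableSet_le measurable_norm measurable_const)
  have hSd : Pairwise (Function.onFun Disjoint S) := by
    have key : ∀ i j : ℕ, i < j → Disjoint (S i) (S j) := by
      intro i j hij
      refine Set.disjoint_left.2 fun x hi hj => ?_
      have h1 : (2 : ℝ) ^ (i + 1) ≤ 2 ^ j := pow_le_pow_right₀ one_le_two hij
      rw [pow_succ] at h1
      have h2 := hi.2
      have h3 := hj.1
      nlinarith
    intro i j hij
    rcases lt_or_gt_of_ne hij with h | h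
    · exact key i j h
    · exact (key j i h).symm
  have hν : 0 ≤ (n : ℝ) / p - n := by
    rw [sub_nonneg]
    exact le_div_self (Nat.cast_nonneg n) hp hp1
  set v := (volume (Metric.ball (0 : Rn n) 1)).toReal with hv
  have hv0 : 0 < v := volume_unitBall_pos n
  have hlow : ∀ l : ℕ, ENNReal.ofReal ((c₀ ^ p * ((ρ₀ / 4) ^ n * v)) * (1 / ((l : ℝ) + 1))) ≤
      ∫⁻ x in S l, F x := by
    intro l
    have hl : (0 : ℝ) < 2 ^ l := by positivity
    have hx : ∀ x ∈ S l, ENNReal.ofReal (c₀ ^ p * (((l : ℝ) + 1)⁻¹ * (((2 : ℝ) ^ l) ^ n)⁻¹)) ≤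
        F x := by
      intro x hx
      have h1 := le_norm_multiplierOp_lacunary_testFunction (a := a) (κ := 1 / p) hn
        (by positivity) hν hθ ht ht0 htc hφ l hx.2
      have h2 : lacunaryCoeff (1 / p) (n / p - n) l * (((2 : ℝ) ^ l) ^ n)⁻¹ * c₀ =
          (c₀ ^ p * (((l : ℝ) + 1)⁻¹ * (((2 : ℝ) ^ l) ^ n)⁻¹)) ^ (1 / p) := by
        rw [Real.mul_rpow (by positivity) (by positivity), ← Real.rpow_mul hc.le,
          mul_one_div_cancel hp.ne', Real.rpow_one, Real.mul_rpow (by positivity) (by positivity),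
          lacunaryCoeff, Real.rpow_neg (by positivity), Real.inv_rpow (by positivity)]
        have h3 : (2 : ℝ) ^ (-((l : ℝ) * (n / p - n))) * (((2 : ℝ) ^ l) ^ n)⁻¹ =
            ((((2 : ℝ) ^ l) ^ n)⁻¹) ^ (1 / p) := by
          rw [← pow_mul, ← Real.rpow_natCast, ← Real.rpow_neg two_pos.le, ← Real.rpow_mul two_pos.le,
            ← Real.rpow_add two_pos]
          congr 1
          push_cast
          ring
        rw [← h3]
        ring
      rw [h2] at h1
      simp only [hF]
      rw [← ofReal_norm, ENNReal.ofReal_rpow_of_nonneg (norm_nonneg _) hp.le]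
      refine ENNReal.ofReal_le_ofReal ?_
      calc _ = ((c₀ ^ p * (((l : ℝ) + 1)⁻¹ * (((2 : ℝ) ^ l) ^ n)⁻¹)) ^ (1 / p)) ^ p := by
            rw [← Real.rpow_mul (by positivity), one_div_mul_cancel hp.ne', Real.rpow_one]
        _ ≤ _ := by gcongr
    -- The annulus contains a ball centred in the middle of it, on the ray through `a`.
    have hvol : ENNReal.ofReal ((ρ₀ / 4 * 2 ^ l) ^ n * v) ≤ volume (S l) := by
      rw [hv, ← volume_ball_eq ((3 / 8 * ρ₀ * 2 ^ l) • a) (by positivity)]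
      refine measure_mono fun x hx => ?_
      rw [Metric.mem_ball, dist_eq_norm] at hx
      have h1 : ‖(3 / 8 * ρ₀ * 2 ^ l) • a‖ = 3 / 4 * ρ₀ * 2 ^ l := by
        rw [norm_smul, ha, Real.norm_of_nonneg (by positivity)]
        ring
      have h2 := norm_sub_norm_le x ((3 / 8 * ρ₀ * 2 ^ l) • a)
      have h3 := norm_sub_norm_le ((3 / 8 * ρ₀ * 2 ^ l) • a) x
      rw [norm_sub_rev] at h3
      rw [h1] at h2 h3
      constructor
      · linarith
      · linarith
    calc _ = ENNReal.ofReal (c₀ ^ p * (((l : ℝ) + 1)⁻¹ * (((2 : ℝ) ^ l) ^ n)⁻¹)) *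
          ENNReal.ofReal ((ρ₀ / 4 * 2 ^ l) ^ n * v) := by
          rw [← ENNReal.ofReal_mul (by positivity), mul_pow (ρ₀ / 4)]
          congr 1
          field_simp
      _ ≤ ENNReal.ofReal (c₀ ^ p * (((l : ℝ) + 1)⁻¹ * (((2 : ℝ) ^ l) ^ n)⁻¹)) * volume (S l) := by
          gcongr
      _ = ∫⁻ x in S l, ENNReal.ofReal (c₀ ^ p * (((l : ℝ) + 1)⁻¹ * (((2 : ℝ) ^ l) ^ n)⁻¹)) :=
          (setLIntegral_const _ _).symm
      _ ≤ _ := setLIntegral_mono' (hSm l) hx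
  by_contra hne
  have hsum : ∑' l : ℕ,
      ENNReal.ofReal ((c₀ ^ p * ((ρ₀ / 4) ^ n * v)) * (1 / ((l : ℝ) + 1))) ≠ ∞ := by
    refine ne_top_of_le_ne_top hne ?_
    calc _ ≤ ∑' l, ∫⁻ x in S l, F x := ENNReal.tsum_le_tsum hlow
      _ = ∫⁻ x in ⋃ l, S l, F x := (lintegral_iUnion hSm hSd _).symm
      _ ≤ _ := setLIntegral_le_lintegral _ _
  have h1 : Summable fun l : ℕ => (c₀ ^ p * ((ρ₀ / 4) ^ n * v)) * (1 / ((l : ℝ) + 1)) :=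
    (ENNReal.summable_toReal hsum).congr fun l => ENNReal.toReal_ofReal (by positivity)
  rw [summable_mul_left_iff (by positivity)] at h1
  refine Real.not_summable_one_div_natCast ((summable_nat_add_iff 1).1 (h1.congr fun l => ?_))
  push_cast
  rfl

/-- The phases of a nonnegative density concentrated within `ρ` of one frequency do not cancel at
points of norm at most `1 / (2πρ)`: there the cosine of the phase difference is at least `1 / 2`. -/
theorem half_integral_le_norm_integral_mul_exp {n : ℕ} {g : Rn n → ℝ} (hg : Integrable g)
    (hg0 : ∀ ξ, 0 ≤ g ξ) {a x : Rn n} {ρ : ℝ} (ha : ∀ ξ, g ξ ≠ 0 → ‖ξ - a‖ ≤ ρ)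
    (hx : 2 * Real.pi * (‖x‖ * ρ) ≤ 1) :
    (∫ ξ, g ξ) / 2 ≤
      ‖∫ ξ, (g ξ : ℂ) * Complex.exp (2 * Real.pi * Complex.I * (inner ℝ x ξ : ℝ))‖ := by
  have h1 : ∀ ξ, (g ξ : ℂ) * Complex.exp (2 * Real.pi * Complex.I * (inner ℝ x ξ : ℝ)) =
      Complex.exp (2 * Real.pi * Complex.I * (inner ℝ x a : ℝ)) *
        ((g ξ : ℂ) * Complex.exp ((2 * Real.pi * inner ℝ x (ξ - a) : ℝ) * Complex.I)) := by
    intro ξ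
    rw [mul_left_comm, ← Complex.exp_add, inner_sub_right]
    congr 2
    push_cast
    ring
  have hi : Integrable fun ξ => (g ξ : ℂ) *
      Complex.exp ((2 * Real.pi * inner ℝ x (ξ - a) : ℝ) * Complex.I) := by
    refine hg.ofReal.mul_bdd (c := 1) (Continuous.aestronglyMeasurable (by fun_prop))
      (Filter.Eventually.of_forall fun ξ => ?_)
    rw [Complex.norm_exp_ofReal_mul_I]
  simp_rw [h1]
  rw [integral_const_mul, norm_mul, norm_exp_two_pi_inner, one_mul]
  refine le_trans ?_ (Complex.re_le_norm _)
  have h2 := integral_re hi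
  simp only [RCLike.re_eq_complex_re] at h2
  rw [← h2, ← integral_div]
  refine integral_mono (hg.div_const 2) hi.re fun ξ => ?_
  simp only
  rw [Complex.re_ofReal_mul, Complex.exp_ofReal_mul_I_re]
  rcases eq_or_ne (g ξ) 0 with h | h
  · simp [h]
  · rw [div_eq_mul_one_div]
    refine mul_le_mul_of_nonneg_left ?_ (hg0 ξ)
    refine le_trans ?_ Real.one_sub_sq_div_two_le_cos
    have h3 : |2 * Real.pi * inner ℝ x (ξ - a)| ≤ 1 := by
      rw [abs_mul, abs_of_pos Real.two_pi_pos]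
      refine le_trans ?_ hx
      gcongr
      refine (abs_real_inner_le_norm _ _).trans ?_
      gcongr
      exact ha ξ h
    have h4 := sq_le_one_iff_abs_le_one _ |>.2 h3
    linarith

/-- On the `l`-th test function all terms `k ≤ l` of the series add up, which gives a harmonic
sum. -/
theorem le_norm_multiplierOp_testFunction {n : ℕ} (hn : 0 < n) {θ φ : 𝓢(Rn n, ℂ)}
    {θr φr : Rn n → ℝ} {a : Rn n} {c₀ ρ₀ : ℝ} (hρ : 0 < ρ₀) (hρ1 : ρ₀ ≤ 1 / 2)
    (hθr : ∀ x, θ x = θr x) (hθ0 : ∀ x, 0 ≤ θr x) (hθc : ∀ x, ‖x‖ ≤ ρ₀ → c₀ ≤ θr x)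
    (hθ : ∀ x, θ x ≠ 0 → ‖x‖ < 1 / 2)
    (hφr : ∀ x, φ x = φr x) (hφ0 : ∀ x, 0 ≤ φr x) (hφ1 : ∀ x, ‖x‖ ≤ 1 / 2 → φr x = 1)
    (hφ : ∀ x, φr x ≠ 0 → ‖x‖ < 3 / 4) (l : ℕ) {x : Rn n} (hx : 2 * Real.pi * ‖x‖ ≤ 2 ^ l) :
    (c₀ * ∑ k ∈ Finset.range (l + 1), 1 / ((k : ℝ) + 1)) *
      ((ρ₀ * ((2 : ℝ) ^ l)⁻¹) ^ n * (volume (Metric.ball (0 : Rn n) 1)).toReal) / 2 ≤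
      ‖multiplierOp (lacunaryMultiplier θ a 1 0) (testFunction φ a l) x‖ := by
  have hl : (0 : ℝ) < 2 ^ l := by positivity
  set S : Rn n → ℝ := fun ξ => ∑' k, lacunaryCoeff 1 0 k * θr ((2 : ℝ) ^ k • (ξ - a)) with hS
  have hSpos : ∀ ξ (k : ℕ), 0 ≤ lacunaryCoeff 1 0 k * θr ((2 : ℝ) ^ k • (ξ - a)) := fun ξ k =>
    mul_nonneg (lacunaryCoeff_pos _ _ _).le (hθ0 _)
  have hσ : ∀ ξ, lacunaryMultiplier θ a 1 0 ξ = (S ξ : ℂ) := by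
    intro ξ
    rw [lacunaryMultiplier, hS, Complex.ofReal_tsum]
    exact tsum_congr fun k => by rw [hθr, Complex.ofReal_mul]
  set g : Rn n → ℝ := fun ξ => S ξ * φr ((2 : ℝ) ^ l • (ξ - a)) with hg
  have hg0 : ∀ ξ, 0 ≤ g ξ := fun ξ => mul_nonneg (tsum_nonneg (hSpos ξ)) (hφ0 _)
  have hgC : ∀ ξ, lacunaryMultiplier θ a 1 0 ξ * 𝓕 (testFunction φ a l) ξ = (g ξ : ℂ) := by
    intro ξ
    rw [hσ, fourier_testFunction, hφr, ← Complex.ofReal_mul]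
  have hgi : Integrable g := by
    have h1 : Integrable fun ξ => lacunaryMultiplier θ a 1 0 ξ * 𝓕 (testFunction φ a l) ξ :=
      ((integrable_lacunaryMultiplier hn a zero_le_one le_rfl hθ).mul_bdd
        (c := SchwartzMap.seminorm ℂ 0 0 (𝓕 (testFunction φ a l)))
        (𝓕 (testFunction φ a l)).continuous.aestronglyMeasurable
        (Filter.Eventually.of_forall fun ξ => (𝓕 (testFunction φ a l)).norm_le_seminorm ℂ ξ) :)
    refine h1.re.congr (Filter.Eventually.of_forall fun ξ => ?_)
    simp only [hgC, RCLike.re_eq_complex_re, Complex.ofReal_re]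
  have hgs : ∀ ξ, g ξ ≠ 0 → ‖ξ - a‖ ≤ ((2 : ℝ) ^ l)⁻¹ := by
    intro ξ h
    have h1 := hφ _ (right_ne_zero_of_mul h)
    rw [norm_smul, Real.norm_of_nonneg hl.le] at h1
    rw [← one_div, le_div_iff₀' hl]
    linarith
  have key := half_integral_le_norm_integral_mul_exp hgi hg0 hgs (x := x) (by
    rw [← mul_assoc, ← div_eq_mul_inv, div_le_one hl]
    exact hx)
  rw [multiplierOp]
  simp_rw [hgC]
  refine le_trans ?_ key
  gcongr
  set H := ∑ k ∈ Finset.range (l + 1), 1 / ((k : ℝ) + 1) with hH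
  set B := Metric.ball a (ρ₀ * ((2 : ℝ) ^ l)⁻¹) with hB
  have hlow : ∀ᵐ ξ, B.indicator (fun _ => c₀ * H) ξ ≤ g ξ := by
    have hL := lintegral_tsum_lacunary_lt_top hn a (κ := 1) zero_le_one le_rfl hθ
    have hm : AEMeasurable fun ξ : Rn n =>
        ∑' k, ‖((lacunaryCoeff 1 0 k : ℝ) : ℂ) * θ ((2 : ℝ) ^ k • (ξ - a))‖ₑ :=
      AEMeasurable.tsum fun k => by fun_prop
    filter_upwards [ae_lt_top' hm hL.ne] with ξ hξ
    by_cases hξB : ξ ∈ B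
    · rw [Set.indicator_of_mem hξB]
      rw [hB, Metric.mem_ball, dist_eq_norm, ← div_eq_mul_inv, lt_div_iff₀' hl] at hξB
      have hsum : Summable fun k => lacunaryCoeff 1 0 k * θr ((2 : ℝ) ^ k • (ξ - a)) := by
        refine (ENNReal.summable_toReal hξ.ne).congr fun k => ?_
        rw [hθr, ← Complex.ofReal_mul, ← ofReal_norm, Complex.norm_real,
          Real.norm_of_nonneg (hSpos ξ k), ENNReal.toReal_ofReal (hSpos ξ k)]
      simp only [hg]
      rw [hφ1, mul_one]
      · refine le_trans ?_ (hsum.sum_le_tsum (Finset.range (l + 1)) fun k _ => hSpos ξ k)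
        rw [hH, Finset.mul_sum]
        refine Finset.sum_le_sum fun k hk => ?_
        have h1 : lacunaryCoeff 1 0 k = 1 / ((k : ℝ) + 1) := by
          rw [lacunaryCoeff, mul_zero, neg_zero, Real.rpow_zero, mul_one, Real.rpow_neg_one,
            one_div]
        rw [h1, mul_comm]
        gcongr
        refine hθc _ ?_
        rw [norm_smul, Real.norm_of_nonneg (by positivity)]
        refine le_trans ?_ hξB.le
        gcongr
        · exact one_le_two
        · exact Nat.lt_succ_iff.1 (Finset.mem_range.1 hk)
      · rw [norm_smul, Real.norm_of_nonneg hl.le]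
        linarith
    · rw [Set.indicator_of_notMem hξB]
      exact hg0 ξ
  have hBv : volume.real B = (ρ₀ * ((2 : ℝ) ^ l)⁻¹) ^ n *
      (volume (Metric.ball (0 : Rn n) 1)).toReal := by
    rw [Measure.real, hB, volume_ball_eq a (by positivity), ENNReal.toReal_ofReal (by positivity)]
  have hint : ∫ ξ, B.indicator (fun _ => c₀ * H) ξ = c₀ * H * volume.real B := by
    rw [integral_indicator Metric.isOpen_ball.measurableSet, setIntegral_const, smul_eq_mul,
      mul_comm]
  rw [← hBv, ← hint]
  refine integral_mono_ae ?_ hgi hlow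
  refine (integrable_indicator_iff Metric.isOpen_ball.measurableSet).2 ?_
  exact integrableOn_const (measure_ball_lt_top).ne

/-- Both the `L^p` norm of `T_σ f` on a large ball and the Hardy norm of `f` scale like
`2 ^ (-l n) 2 ^ (l n / p)` for the `l`-th test function, but the former carries an additional harmonic sum. -/
theorem not_isBoundedOnHardy_lacunaryMultiplier_one_zero {n : ℕ} (hn : 0 < n) {Φ : 𝓢(Rn n, ℂ)}
    (hΦ : IsHardyKernel Φ) {p : ℝ} (hp : 0 < p) {θ : 𝓢(Rn n, ℂ)} {θr : Rn n → ℝ} {a : Rn n}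
    (ha : ‖a‖ = 2) {c₀ ρ₀ : ℝ} (hc : 0 < c₀) (hρ : 0 < ρ₀) (hρ1 : ρ₀ ≤ 1 / 2)
    (hθr : ∀ x, θ x = θr x) (hθ0 : ∀ x, 0 ≤ θr x) (hθc : ∀ x, ‖x‖ ≤ ρ₀ → c₀ ≤ θr x)
    (hθ : ∀ x, θ x ≠ 0 → ‖x‖ < 1 / 2) :
    ¬ IsBoundedOnHardy Φ p (lacunaryMultiplier θ a 1 0) := by
  intro hbd
  obtain ⟨φ, φr, hφr, hφ0, hφ1, hφ⟩ := exists_cutoff n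
  obtain ⟨C, hC⟩ := hbd.exists_lintegral_le hΦ.1 hp
    (integrable_lacunaryMultiplier hn a zero_le_one le_rfl hθ)
  obtain ⟨D, hD0, hD⟩ := exists_hardyNorm_testFunction_le hΦ.2 ha (φ := φ)
    (fun ξ h => hφ ξ fun h0 => h (by rw [hφr, h0, Complex.ofReal_zero])) hp
  set v := (volume (Metric.ball (0 : Rn n) 1)).toReal with hv
  have hv0 : 0 < v := volume_unitBall_pos n
  set K : ℝ := c₀ * (ρ₀ ^ n * v) / 2 * (((2 * Real.pi)⁻¹ ^ n * v) ^ (1 / p)) with hK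
  have hK0 : 0 < K := by
    have := Real.pi_pos
    positivity
  have hbound : ∀ l : ℕ, K * ∑ k ∈ Finset.range (l + 1), 1 / ((k : ℝ) + 1) ≤ C * D := by
    intro l
    have hl : (0 : ℝ) < 2 ^ l := by positivity
    set H := ∑ k ∈ Finset.range (l + 1), 1 / ((k : ℝ) + 1) with hH
    have hH0 : 0 ≤ H := Finset.sum_nonneg fun k _ => by positivity
    set A : ℝ := c₀ * H * ((ρ₀ * ((2 : ℝ) ^ l)⁻¹) ^ n * v) / 2 with hA
    have hA0 : 0 ≤ A := by positivity
    set R : ℝ := (2 * Real.pi)⁻¹ * 2 ^ l with hR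
    have hR0 : 0 < R := mul_pos (inv_pos.2 Real.two_pi_pos) hl
    have h1 : ENNReal.ofReal (A * (R ^ n * v) ^ (1 / p)) ≤
        (∫⁻ x, ‖multiplierOp (lacunaryMultiplier θ a 1 0) (testFunction φ a l) x‖ₑ ^ p) ^
          (1 / p) := by
      calc _ = (ENNReal.ofReal (A ^ p) * volume (Metric.ball (0 : Rn n) R)) ^ (1 / p) := by
            rw [volume_ball_eq 0 hR0, ← ENNReal.ofReal_mul (by positivity),
              ENNReal.ofReal_rpow_of_nonneg (by positivity) (by positivity),
              Real.mul_rpow (x := A ^ p) (by positivity) (by positivity), ← Real.rpow_mul hA0,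
              mul_one_div_cancel hp.ne', Real.rpow_one]
        _ = (∫⁻ x in Metric.ball (0 : Rn n) R, ENNReal.ofReal (A ^ p)) ^ (1 / p) := by
            rw [setLIntegral_const]
        _ ≤ (∫⁻ x in Metric.ball (0 : Rn n) R, ‖multiplierOp (lacunaryMultiplier θ a 1 0)
              (testFunction φ a l) x‖ₑ ^ p) ^ (1 / p) := by
            gcongr ?_ ^ (1 / p)
            refine setLIntegral_mono' Metric.isOpen_ball.measurableSet fun x hx => ?_
            rw [mem_ball_zero_iff, hR, inv_mul_eq_div, lt_div_iff₀' Real.two_pi_pos] at hx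
            rw [← ofReal_norm, ENNReal.ofReal_rpow_of_nonneg (norm_nonneg _) hp.le]
            refine ENNReal.ofReal_le_ofReal ?_
            gcongr
            exact le_norm_multiplierOp_testFunction hn hρ hρ1 hθr hθ0 hθc hθ hφr hφ0 hφ1 hφ l
              hx.le
        _ ≤ _ := by
            gcongr
            exact Measure.restrict_le_self
    have h2 := h1.trans (hC _ ((hD l).trans_lt ENNReal.ofReal_lt_top))
    have h3 := h2.trans (mul_le_mul_right (hD l) _)
    rw [← ENNReal.ofReal_coe_nnreal, ← ENNReal.ofReal_mul C.coe_nonneg,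
      ENNReal.ofReal_le_ofReal_iff (by positivity)] at h3
    have h4 : A * (R ^ n * v) ^ (1 / p) =
        K * H * (((2 : ℝ) ^ l)⁻¹ ^ n * (((2 : ℝ) ^ l) ^ n) ^ (1 / p)) := by
      have h5 : R ^ n * v = ((2 * Real.pi)⁻¹ ^ n * v) * ((2 : ℝ) ^ l) ^ n := by
        rw [hR, mul_pow]
        ring
      have := Real.two_pi_pos
      rw [h5, Real.mul_rpow (by positivity) (by positivity), hA, hK, mul_pow]
      ring
    rw [h4, ← mul_assoc (C : ℝ)] at h3
    exact le_of_mul_le_mul_right h3 (by positivity)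
  have ht := (Real.tendsto_sum_range_one_div_nat_succ_atTop.comp
    (Filter.tendsto_add_atTop_nat 1)).const_mul_atTop hK0
  obtain ⟨l, hl⟩ := (ht.eventually_gt_atTop (C * D)).exists
  exact absurd (hbound l) (not_le.2 hl)

theorem not_isBoundedOnHardy_lacunaryMultiplier_of_le_one {n : ℕ} (hn : 0 < n) {Φ : 𝓢(Rn n, ℂ)}
    (hΦ : IsHardyKernel Φ) {p : ℝ} (hp : 0 < p) (hp1 : p ≤ 1) {θ : 𝓢(Rn n, ℂ)} {t : Rn n → ℝ}
    {a : Rn n} (ha : ‖a‖ = 2) {c₀ ρ₀ : ℝ} (hc : 0 < c₀) (hρ : 0 < ρ₀)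
    (hθ : ∀ x, θ x ≠ 0 → ‖x‖ < 1 / 2) (ht : ∀ x, 𝓕⁻ θ x = t x) (ht0 : ∀ x, 0 ≤ t x)
    (htc : ∀ x, ‖x‖ ≤ ρ₀ → c₀ ≤ t x) :
    ¬ IsBoundedOnHardy Φ p (lacunaryMultiplier θ a (1 / p) (n / p - n)) := by
  intro hbd
  obtain ⟨φ, φr, hφr, hφ0, hφ1, hφ⟩ := exists_cutoff n
  have hν : 0 ≤ (n : ℝ) / p - n := sub_nonneg.2 (le_div_self (Nat.cast_nonneg n) hp hp1)
  obtain ⟨C, hC⟩ := hbd.exists_lintegral_le hΦ.1 hp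
    (integrable_lacunaryMultiplier hn a (by positivity) hν hθ)
  obtain ⟨D, hD0, hD⟩ := exists_hardyNorm_testFunction_le hΦ.2 ha (φ := φ)
    (fun ξ h => hφ ξ fun h0 => h (by rw [hφr, h0, Complex.ofReal_zero])) hp
  have h0 := (hD 0).trans_lt ENNReal.ofReal_lt_top
  have h1 := hC _ h0
  rw [lintegral_multiplierOp_lacunary_eq_top hn ha hp hp1 hc hρ hθ ht ht0 htc
    (fun x hx => by rw [hφr, hφ1 x hx, Complex.ofReal_one]),
    ENNReal.top_rpow_of_pos (by positivity), top_le_iff] at h1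
  exact ENNReal.mul_ne_top ENNReal.coe_ne_top h0.ne h1

/-! ### The counterexamples -/

/-- A single lacunary multiplier, depending on `n` and `p` only, serves every pair of exponents
`(r, q)` for which its Hörmander norm is finite. -/
theorem exists_unbounded_multiplier {n : ℕ} (hn : 0 < n) {p s : ℝ} (hp : 0 < p) (hs0 : 0 < s)
    (hβ : 0 < s - (n / min 1 p - n)) (hsn : s < (n : ℝ) / min 1 p)
    {Φ Ψ : 𝓢(Rn n, ℂ)} (hΦ : IsHardyKernel Φ) (hΨ : IsDyadicPartition Ψ) {r : ℝ} {q : ℝ≥0∞}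
    (hr : 0 < r) (hq : 0 < q)
    (h : s - (n / min 1 p - n) < n / r ∨
      s - (n / min 1 p - n) = n / r ∧ (q = ∞ ∨ 1 < 1 / min 1 p * q.toReal)) :
    ∃ σ : Rn n → ℂ, Integrable σ volume ∧ (p < 1 → ∃ M : ℝ, ∀ ξ, ‖σ ξ‖ ≤ M) ∧
      hormanderSup Ψ s r q σ < ∞ ∧ ¬ IsBoundedOnHardy Φ p σ := by
  have hm0 : 0 < min 1 p := lt_min one_pos hp
  have hν : 0 ≤ (n : ℝ) / min 1 p - n :=
    sub_nonneg.2 (le_div_self (Nat.cast_nonneg n) hm0 (min_le_left _ _))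
  have hκ : 0 ≤ 1 / min 1 p := by positivity
  obtain ⟨θ, θr, t, c₀, ρ₀, hc, hρ, hρ1, hθr, hθ0, hθc, hθ, ht, ht0, htc⟩ := exists_positive_bump n
  have ha : ‖EuclideanSpace.single (⟨0, hn⟩ : Fin n) (2 : ℝ)‖ = 2 := by simp
  set a := EuclideanSpace.single (⟨0, hn⟩ : Fin n) (2 : ℝ)
  refine ⟨lacunaryMultiplier θ a (1 / min 1 p) (n / min 1 p - n),
    integrable_lacunaryMultiplier hn a hκ hν hθ, fun hp1 => ?_, ?_, ?_⟩
  · refine exists_norm_lacunaryMultiplier_le θ a hκ ?_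
    rw [min_eq_right hp1.le, sub_pos, lt_div_iff₀ hp]
    exact mul_lt_of_lt_one_right (by exact_mod_cast hn) hp1
  · have := hormanderSup_lacunaryMultiplier_lt_top hn hs0 hβ (by linarith) (by linarith) hκ hr hq h
      hΨ.1 hθ ha
    rwa [sub_sub_cancel] at this
  · rcases le_total p 1 with hp1 | hp1
    · rw [min_eq_right hp1]
      exact not_isBoundedOnHardy_lacunaryMultiplier_of_le_one hn hΦ hp hp1 ha hc hρ hθ ht ht0 htc
    · rw [min_eq_left hp1, div_one, div_one, sub_self]
      exact not_isBoundedOnHardy_lacunaryMultiplier_one_zero hn hΦ hp ha hc hρ hρ1 hθr hθ0 hθc hθ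

end HardyMultiplier

theorem theorem1p2 (n : ℕ) (p s : ℝ) (hp : 0 < p)
    (hs : |(n : ℝ) / p - (n : ℝ) / 2| < s) (hsn : s < (n : ℝ) / min 1 p)
    (Φ Ψ : 𝓢(HardyMultiplier.Rn n, ℂ))
    (hΦ : HardyMultiplier.IsHardyKernel Φ) (hΨ : HardyMultiplier.IsDyadicPartition Ψ) :
    (∀ (r : ℝ) (q : ℝ≥0∞), 0 < r → r < HardyMultiplier.tau n s p → 0 < q →
      ∃ σ : HardyMultiplier.Rn n → ℂ,
        Integrable σ volume ∧ (p < 1 → ∃ M : ℝ, ∀ ξ, ‖σ ξ‖ ≤ M) ∧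
        HardyMultiplier.hormanderSup Ψ s r q σ < ∞ ∧
        ¬ HardyMultiplier.IsBoundedOnHardy Φ p σ) ∧
    (∀ q : ℝ≥0∞, ENNReal.ofReal (min 1 p) < q →
      ∃ σ : HardyMultiplier.Rn n → ℂ,
        Integrable σ volume ∧ (p < 1 → ∃ M : ℝ, ∀ ξ, ‖σ ξ‖ ≤ M) ∧
        HardyMultiplier.hormanderSup Ψ s (HardyMultiplier.tau n s p) q σ < ∞ ∧
        ¬ HardyMultiplier.IsBoundedOnHardy Φ p σ) := by
  have hs0 : 0 < s := (abs_nonneg _).trans_lt hs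
  have hn : 0 < n := by
    rcases Nat.eq_zero_or_pos n with rfl | h
    · rw [Nat.cast_zero, zero_div] at hsn
      exact absurd hsn hs0.not_gt
    · exact h
  have hn' : (0 : ℝ) < n := Nat.cast_pos.2 hn
  have hm0 : 0 < min 1 p := lt_min one_pos hp
  have hβ : 0 < s - (n / min 1 p - n) := by
    rcases le_total p 1 with hp1 | hp1
    · rw [min_eq_right hp1]
      have := (le_abs_self _).trans_lt hs
      linarith
    · rw [min_eq_left hp1, div_one, sub_self, sub_zero]
      exact hs0
  refine ⟨fun r q hr hrt hq => ?_, fun q hq => ?_⟩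
  · refine HardyMultiplier.exists_unbounded_multiplier hn hp hs0 hβ hsn hΦ hΨ hr hq (Or.inl ?_)
    rwa [lt_div_iff₀' hr, ← lt_div_iff₀ hβ]
  · refine HardyMultiplier.exists_unbounded_multiplier hn hp hs0 hβ hsn hΦ hΨ (div_pos hn' hβ)
      (bot_le.trans_lt hq) (Or.inr ⟨?_, ?_⟩)
    · rw [HardyMultiplier.tau, div_div_cancel₀ hn'.ne']
    · refine or_iff_not_imp_left.2 fun hq' => ?_
      rw [one_div_mul_eq_div, one_lt_div hm0]
      exact (ENNReal.ofReal_lt_iff_lt_toReal hm0.le hq').1 hq
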